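/- Let $c,\beta,\gamma>0$, $\alpha\in\mathbb R$, and for $Q\in\mathbb R^{3\times3}$ put $$f(Q)=-\alpha Q+\beta\bigl(Q^2-\tfrac13\operatorname{tr}(Q^2)I\bigr)-\gamma\operatorname{tr}(Q^2)Q .$$ Let $\|\cdot\|_F$ be the Frobenius norm and let $\mathcal Q_{\rm phys}$ be the set of symmetric traceless $Q\in\mathbb R^{3\times 3}$ with all eigenvalues in $(-\frac13,\frac23)$. Let $\Omega=(0,L_1)\times(0,L_2)\times(0,L_3)$ be a periodic cell, $\|Q\|_{\mathcal Z}=\max_{x\in\overline\Omega}\|Q(x)\|_F$, and let $\mathcal Y$ be the set of $\Omega$-periodic $W^{1,\infty}$ fields (identified with their continuous representatives) with values in $\mathcal Q_{\rm phys}$, with the $W^{1,\infty}$ norm. Let $e^{t\Delta}$ be the heat semigroup on $\Omega$-periodic fields. Let $a>0$ with $b:=\frac{\beta^2}{\gamma^2}-\frac{2\alpha}{\gamma}\le a^2$. Let $C>0$, $C_f$, $C_\partial$ be constants such that for all $A,B\in\mathcal Q_{\rm phys}$ with $\|A\|_F,\|B\|_F\le a$ $$\|f(A)-f(B)\|_F\le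 C\|A-B\|_F,\qquad \|f(A)\|_F\le C_f\|A\|_F,\qquad \Bigl\|\frac{\partial f}{\partial Q}(A):f(A)\Bigr\|_F\le C_\partial\|A\|_F,$$ and put $$\widehat{C_f}=\max\Bigl\{C_f,\frac{\gamma^2}{4}(2a^2-b)^2\Bigr\},\qquad \tau_0=\frac{\gamma(a^2-b)}{\widehat{C_f}^2+C_\partial^2+1}.$$ Let $T>0$ and let $Q\in C([0,T];\mathcal Y)$ be a (weak) solution of $Q_t=c\Delta Q+f(Q)$ with $\Omega$-periodic boundary conditions and $Q(0)=Q_0$, where $\|Q_0(x)\|_F\le a$ for all $x$. For a positive integer $n$ put $\tau=T/n$, $t_m=m\tau$, and let $Q_m$ be generated from $Q_0$ by the LRI1b scheme $$Q_{m+1}=e^{c\tau\Delta}Q_m+\tau f(e^{c\tau\Delta}Q_m).$$ Then there is a constant $C_5>0$, independent of $\tau$ (that is, of $n$) and of $m$, such that for all $n\ge1$ with $\tau=T/n\le\tau_0$ and all $1\le m\le n$ $$\|Q_m-Q(t_m)\|_{\mathcal Z}\le\frac{C_5(e^{CT}-1)}{C}\,\tau .$$ -/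

import Mathlib

open MeasureTheory Set Filter Topology
open scoped ContDiff ENNReal

noncomputable section

namespace QTensor

/-- Physical space. -/
abbrev E3 : Type := EuclideanSpace ℝ (Fin 3)

/-- Second-order tensors. -/
abbrev Mat3 : Type := Matrix (Fin 3) (Fin 3) ℝ

/-- The double contraction `A : B`. -/
def contract (A B : Mat3) : ℝ := ∑ i, ∑ j, A i j * B i j

/-- The Frobenius norm of a second-order tensor. -/
def frob (A : Mat3) : ℝ := Real.sqrt (contract A A)

/-- The Frobenius norm of a third-order tensor `(G k) i j`, the value of a gradient. -/
def gradFrob (G : Fin 3 → Mat3) : ℝ := Real.sqrt (∑ k, contract (G k) (G k))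

/-- The physical Q-tensors: symmetric, traceless, with all eigenvalues in `(-1/3, 2/3)`. -/
def Qphys : Set Mat3 :=
  {A | A.IsSymm ∧ A.trace = 0 ∧ ∀ μ ∈ spectrum ℝ A, -(1 / 3) < μ ∧ μ < 2 / 3}

/-- The bulk nonlinearity
`f(Q) = -α Q + β (Q² - (1/3) tr(Q²) I) - γ tr(Q²) Q`. -/
def bulk (α β γ : ℝ) (A : Mat3) : Mat3 :=
  -(α • A) + β • (A * A - ((1 / 3) * (A * A).trace) • (1 : Mat3)) - (γ * (A * A).trace) • A

/-- `(∂f/∂Q)(A) : H`, with entries `∑ k l, ∂f_ij/∂Q_kl (A) H_kl`; since `f` is a polynomial this is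
the derivative of `f` at `A` in the direction `H`. -/
def bulkDeriv (α β γ : ℝ) (A H : Mat3) : Mat3 :=
  Matrix.of fun i j => deriv (fun s : ℝ => bulk α β γ (A + s • H) i j) 0

/-- The closure of the periodic cell `Ω = (0, L 0) × (0, L 1) × (0, L 2)`. -/
def closedCell (L : Fin 3 → ℝ) : Set E3 := {x | ∀ i, 0 ≤ x i ∧ x i ≤ L i}

/-- `Ω`-periodic fields on the whole space. -/
def IsPeriodic (L : Fin 3 → ℝ) (u : E3 → Mat3) : Prop :=
  ∀ (i : Fin 3) (x : E3), u (x + EuclideanSpace.single i (L i)) = u x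

/-- The norm `max_{x ∈ closure Ω} ‖u x‖_F`, as an extended real. -/
def normZ (L : Fin 3 → ℝ) (u : E3 → Mat3) : ℝ≥0∞ :=
  ⨆ x ∈ closedCell L, ENNReal.ofReal (frob (u x))

/-- Test functions on the whole space. -/
def IsTest (φ : E3 → ℝ) : Prop := ContDiff ℝ ∞ φ ∧ HasCompactSupport φ

/-- `G k` is the weak partial derivative of `u` in the direction of the `k`-th coordinate. -/
def IsWeakGradient (u : E3 → Mat3) (G : Fin 3 → E3 → Mat3) : Prop :=
  ∀ k i j, LocallyIntegrable (fun x => G k x i j) ∧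
    ∀ φ : E3 → ℝ, IsTest φ →
      ∫ x, u x i j * fderiv ℝ φ x (EuclideanSpace.single k 1) = -∫ x, G k x i j * φ x

/-- The `W^{1,∞}` norm of a (continuous) field: the essential supremum of `‖u‖_F` plus that of the
Frobenius norm of its weak gradient. The latter is unique up to null sets, so the infimum is over
one class; it is `⊤` if there is no weak gradient. For periodic fields the essential suprema over
the whole space are those over `Ω`. -/
def normW1inf (u : E3 → Mat3) : ℝ≥0∞ :=
  essSup (fun x => ENNReal.ofReal (frob (u x))) volume +
    ⨅ (G : Fin 3 → E3 → Mat3) (_ : IsWeakGradient u G),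
      essSup (fun x => ENNReal.ofReal (gradFrob fun k => G k x)) volume

/-- The set `𝒴` of `Ω`-periodic fields of class `W^{1,∞}` with values in `Qphys`; an element is
given by its continuous representative. -/
def spaceY (L : Fin 3 → ℝ) : Set (E3 → Mat3) :=
  {u | Continuous u ∧ IsPeriodic L u ∧ (∀ x, u x ∈ Qphys) ∧ normW1inf u < ⊤}

/-- `Q ∈ C([0,T]; 𝒴)`, continuity being with respect to the `W^{1,∞}` norm. -/
def IsContinuousInY (T : ℝ) (L : Fin 3 → ℝ) (Q : ℝ → E3 → Mat3) : Prop :=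
  ∀ t ∈ Icc 0 T, Q t ∈ spaceY L ∧
    Tendsto (fun s => normW1inf (Q s - Q t)) (𝓝[Icc 0 T] t) (𝓝 0)

/-- `Q` solves `Q_t = c ΔQ + f(Q)` on `[0,T]` with periodic boundary conditions and `Q(0) = Q₀`.
The equation is meant in the weak sense: it is tested, entry by entry, with smooth compactly
supported functions of `x` and integrated from `0` to `t`. -/
structure IsSolution (c α β γ T : ℝ) (L : Fin 3 → ℝ) (Q₀ : E3 → Mat3) (Q : ℝ → E3 → Mat3) :
    Prop where
  periodic : ∀ t ∈ Icc 0 T, IsPeriodic L (Q t)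
  initial : Q 0 = Q₀
  equation : ∀ t ∈ Icc 0 T, ∀ i j, ∀ φ : E3 → ℝ, IsTest φ →
    ∫ x, Q t x i j * φ x = (∫ x, Q₀ x i j * φ x) +
      ∫ s in (0 : ℝ)..t, ∫ x,
        (c * (Q s x i j * Laplacian.laplacian φ x) + bulk α β γ (Q s x) i j * φ x)

/-- The Gaussian heat kernel of the three-dimensional space, for `t > 0`. -/
def heatKernel (t : ℝ) (z : E3) : ℝ :=
  (4 * Real.pi * t) ^ (-(3 / 2) : ℝ) * Real.exp (-(‖z‖ ^ 2) / (4 * t))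

/-- The heat semigroup `e^{tΔ}`, `t ≥ 0`, acting entrywise on bounded continuous fields on the whole
space; on `Ω`-periodic fields it is the semigroup of the Laplacian with periodic boundary
conditions. -/
def heat (t : ℝ) (u : E3 → Mat3) : E3 → Mat3 :=
  if 0 < t then fun x => Matrix.of fun i j => ∫ y, heatKernel t (x - y) * u y i j else u

/-- The scheme `Q_{m+1} = e^{cτΔ} Q_m + τ f(e^{cτΔ} Q_m)` started from `Q₀`. -/
def lri1b (c α β γ τ : ℝ) (Q₀ : E3 → Mat3) : ℕ → E3 → Mat3
  | 0 => Q₀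
  | m + 1 => fun x =>
      heat (c * τ) (lri1b c α β γ τ Q₀ m) x +
        τ • bulk α β γ (heat (c * τ) (lri1b c α β γ τ Q₀ m) x)

/-- `C` is a Lipschitz constant of `f` on the physical tensors of Frobenius norm at most `a`, and
there `‖f(A)‖_F ≤ Cf ‖A‖_F` and `‖(∂f/∂Q)(A) : f(A)‖_F ≤ Cd ‖A‖_F`. -/
structure IsBulkConstants (α β γ a C Cf Cd : ℝ) : Prop where
  lipschitz : ∀ A ∈ Qphys, ∀ B ∈ Qphys, frob A ^ 2 ≤ a ^ 2 → frob B ^ 2 ≤ a ^ 2 →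
    frob (bulk α β γ A - bulk α β γ B) ≤ C * frob (A - B)
  growth : ∀ A ∈ Qphys, frob A ^ 2 ≤ a ^ 2 → frob (bulk α β γ A) ≤ Cf * frob A
  growth_deriv : ∀ A ∈ Qphys, frob A ^ 2 ≤ a ^ 2 →
    frob (bulkDeriv α β γ A (bulk α β γ A)) ≤ Cd * frob A

/-- `b = β²/γ² - 2α/γ`. -/
def bConst (α β γ : ℝ) : ℝ := β ^ 2 / γ ^ 2 - 2 * α / γ

/-- The step-size threshold
`τ₀ = γ (a² - b) / (Ĉ_f² + C_∂² + 1)`, with `Ĉ_f = max {C_f, (γ²/4) (2a² - b)²}`. -/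
def tauZero (α β γ a Cf Cd : ℝ) : ℝ :=
  γ * (a ^ 2 - bConst α β γ) /
    (max Cf (γ ^ 2 / 4 * (-bConst α β γ + 2 * a ^ 2) ^ 2) ^ 2 + Cd ^ 2 + 1)

end QTensor

end

noncomputable section

/-! The proof is "consistency plus stability", carried out for a solution that is only Lipschitz in
space.

By compactness of `[0,T]`, a solution in `C([0,T]; 𝒴)` is bounded by some `M` and Lipschitz in space
with some constant `Λ`, uniformly in time. The heat kernel at positive time is a dominated limit of
test functions, so the weak equation may be tested with it. This yields Duhamel's formula `q(t) -
e^{c(t-r)Δ} q(r) = ∫_r^t e^{c(t-s)Δ} f(q(s)) ds`.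

One step of the scheme replaces the integrand by the frozen value `f(e^{c(t-r)Δ} q(r))`. The
replacement costs `O(τ)` pointwise, hence `O(τ²)` per step (`norm_local_error_le`), for two reasons.
First, `e^{σΔ} f(u) - f(e^{σΔ} u) = O(σ)` for Lipschitz `u` (`norm_heatConv_comp_sub_le`): the
linear part of `f` commutes with averaging, and the quadratic Taylor remainder only meets the second
moment of the kernel, of order `σ`, and the square of the displacement `O(√σ)`. No second
derivatives of `u` enter. Second, `s ↦ e^{c(t-s)Δ} q(s)` is Lipschitz in time, since its derivative
is a heat average of the bounded source.

Stability holds because `e^{σΔ}` is a contraction in the supremum norm and the polynomial `f` is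
Lipschitz on balls. A discrete Gronwall argument sums the local errors and, for small `τ`, keeps the
iterates in the ball of radius `M + 1` (`norm_scheme_sub_le`). Only finitely many `n` remain, and
they enlarge the constant. -/

namespace QTensor

/-! ### The heat kernel -/

/-- The common value of `∂_t` and of the Laplacian of the heat kernel. -/
def heatKernelLap (t : ℝ) (z : E3) : ℝ :=
  (‖z‖ ^ 2 / (4 * t ^ 2) - 3 / (2 * t)) * heatKernel t z

lemma heatKernel_pos {t : ℝ} (ht : 0 < t) (z : E3) : 0 < heatKernel t z := by
  unfold heatKernel
  positivity

lemma integral_exp_neg_mul_sq_norm {b : ℝ} (hb : 0 < b) :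
    ∫ z : E3, Real.exp (-b * ‖z‖ ^ 2) = (Real.pi / b) ^ (3 / 2 : ℝ) := by
  rw [GaussianFourier.integral_rexp_neg_mul_sq_norm hb]
  simp

lemma integrable_exp_neg_mul_sq_norm {b : ℝ} (hb : 0 < b) :
    Integrable fun z : E3 => Real.exp (-b * ‖z‖ ^ 2) := by
  -- A non-integrable function has integral `0` by convention, whereas the Gaussian integral is
  -- positive.
  by_contra h
  have h1 := integral_exp_neg_mul_sq_norm hb
  rw [integral_undef h] at h1
  have : 0 < (Real.pi / b) ^ (3 / 2 : ℝ) := by positivity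
  linarith

lemma heatKernel_eq {t : ℝ} (z : E3) :
    heatKernel t z =
      (4 * Real.pi * t) ^ (-(3 / 2) : ℝ) * Real.exp (-(4 * t)⁻¹ * ‖z‖ ^ 2) := by
  unfold heatKernel
  congr 2
  rw [neg_div, div_eq_inv_mul, neg_mul]

lemma integrable_heatKernel {t : ℝ} (ht : 0 < t) : Integrable (heatKernel t) := by
  simp_rw [funext fun z => heatKernel_eq (t := t) z]
  exact (integrable_exp_neg_mul_sq_norm (by positivity)).const_mul _

lemma integral_heatKernel {t : ℝ} (ht : 0 < t) : ∫ z, heatKernel t z = 1 := by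
  simp_rw [heatKernel_eq]
  rw [integral_const_mul, integral_exp_neg_mul_sq_norm (by positivity)]
  have : Real.pi / (4 * t)⁻¹ = 4 * Real.pi * t := by
    rw [div_inv_eq_mul]; ring
  rw [this, ← Real.rpow_add (by positivity)]
  norm_num

/-- Half of the exponential decay absorbs the polynomial factor. This is how every moment and
derivative of the heat kernel is dominated by a wider Gaussian. -/
lemma mul_exp_neg_le {b x : ℝ} (hb : 0 < b) :
    x * Real.exp (-(2 * b) * x) ≤ b⁻¹ * Real.exp (-b * x) := by
  have h1 : b * x ≤ Real.exp (b * x) := by linarith [Real.add_one_le_exp (b * x)]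
  have h2 : Real.exp (b * x) * Real.exp (-(2 * b) * x) = Real.exp (-b * x) := by
    rw [← Real.exp_add]; ring_nf
  rw [← h2, ← mul_assoc]
  refine mul_le_mul_of_nonneg_right ?_ (Real.exp_nonneg _)
  rw [inv_mul_eq_div, le_div_iff₀ hb]
  linarith

lemma sq_norm_mul_heatKernel_le {t : ℝ} (ht : 0 < t) (z : E3) :
    ‖z‖ ^ 2 * heatKernel t z ≤
      (4 * Real.pi * t) ^ (-(3 / 2) : ℝ) * (8 * t) * Real.exp (-(8 * t)⁻¹ * ‖z‖ ^ 2) := by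
  rw [heatKernel_eq]
  have h := mul_exp_neg_le (b := (8 * t)⁻¹) (x := ‖z‖ ^ 2) (by positivity)
  have h2 : 2 * (8 * t)⁻¹ = (4 * t)⁻¹ := by field_simp; norm_num
  rw [h2, inv_inv] at h
  have h3 : 0 ≤ (4 * Real.pi * t) ^ (-(3 / 2) : ℝ) := by positivity
  nlinarith [mul_le_mul_of_nonneg_left h h3]

lemma continuous_heatKernel (t : ℝ) : Continuous (heatKernel t) := by
  unfold heatKernel
  fun_prop

lemma continuous_heatKernelLap (t : ℝ) : Continuous (heatKernelLap t) := by
  unfold heatKernelLap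
  have := continuous_heatKernel t
  fun_prop

lemma integrable_sq_norm_mul_heatKernel {t : ℝ} (ht : 0 < t) :
    Integrable fun z : E3 => ‖z‖ ^ 2 * heatKernel t z := by
  refine ((integrable_exp_neg_mul_sq_norm (b := (8 * t)⁻¹) (by positivity)).const_mul
    ((4 * Real.pi * t) ^ (-(3 / 2) : ℝ) * (8 * t))).mono'
    ((continuous_norm.pow 2).mul (continuous_heatKernel t)).aestronglyMeasurable
    (Eventually.of_forall fun z => ?_)
  rw [Real.norm_of_nonneg (mul_nonneg (sq_nonneg _) (heatKernel_pos ht z).le)]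
  exact sq_norm_mul_heatKernel_le ht z

/-- The exact second moment is `6 t`. Domination by the Gaussian of doubled variance gives `8 t * 2
^ (3/2)`, and `2 ^ (3/2) ≤ 3`; only the order in `t` matters later. -/
lemma integral_sq_norm_mul_heatKernel_le {t : ℝ} (ht : 0 < t) :
    ∫ z : E3, ‖z‖ ^ 2 * heatKernel t z ≤ 24 * t := by
  have hb : 0 < (8 * t)⁻¹ := by positivity
  refine (integral_mono (integrable_sq_norm_mul_heatKernel ht)
    ((integrable_exp_neg_mul_sq_norm hb).const_mul _)
    (sq_norm_mul_heatKernel_le ht)).trans ?_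
  rw [integral_const_mul, integral_exp_neg_mul_sq_norm hb]
  have h1 : Real.pi / (8 * t)⁻¹ = 2 * (4 * Real.pi * t) := by
    rw [div_inv_eq_mul]; ring
  have hp : 0 < 4 * Real.pi * t := by positivity
  rw [h1, Real.mul_rpow (by norm_num) hp.le]
  have h2 : (4 * Real.pi * t) ^ (-(3 / 2) : ℝ) * (4 * Real.pi * t) ^ (3 / 2 : ℝ) = 1 := by
    rw [← Real.rpow_add hp]; norm_num
  have h3 : (2 : ℝ) ^ (3 / 2 : ℝ) ≤ 3 := by
    have : (2 : ℝ) ^ (3 / 2 : ℝ) = Real.sqrt (2 ^ 3) := by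
      rw [Real.sqrt_eq_rpow, ← Real.rpow_natCast, ← Real.rpow_mul (by norm_num)]; norm_num
    rw [this]
    exact Real.sqrt_le_iff.2 ⟨by norm_num, by norm_num⟩
  calc _ = (4 * Real.pi * t) ^ (-(3 / 2) : ℝ) * (4 * Real.pi * t) ^ (3 / 2 : ℝ) *
        ((8 * t) * 2 ^ (3 / 2 : ℝ)) := by ring
    _ ≤ 24 * t := by rw [h2]; nlinarith

/-- Gaussian domination of the heat kernel and its derivatives, locally uniform in time. -/
lemma exists_heatKernel_le_exp {s S : ℝ} (hs : 0 < s) (hS : 0 < S) :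
    ∃ K > 0, ∀ t ∈ Icc s S, ∀ z : E3,
      (1 + ‖z‖ ^ 2) * heatKernel t z ≤ K * Real.exp (-(8 * S)⁻¹ * ‖z‖ ^ 2) := by
  refine ⟨(4 * Real.pi * s) ^ (-(3 / 2) : ℝ) * (1 + 8 * S), by positivity, fun t ht z => ?_⟩
  have htp : 0 < t := hs.trans_le ht.1
  have hb : 0 < (8 * S)⁻¹ := by positivity
  rw [heatKernel_eq]
  have h1 : (4 * Real.pi * t) ^ (-(3 / 2) : ℝ) ≤ (4 * Real.pi * s) ^ (-(3 / 2) : ℝ) := by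
    refine Real.rpow_le_rpow_of_nonpos (by positivity) ?_ (by norm_num)
    have := ht.1
    gcongr
  have h2 : Real.exp (-(4 * t)⁻¹ * ‖z‖ ^ 2) ≤ Real.exp (-(2 * (8 * S)⁻¹) * ‖z‖ ^ 2) := by
    have : 2 * (8 * S)⁻¹ = (4 * S)⁻¹ := by field_simp; norm_num
    rw [this]
    have h : (4 * S)⁻¹ ≤ (4 * t)⁻¹ := by
      have := ht.2
      gcongr
    gcongr
  have h3 := mul_exp_neg_le (x := ‖z‖ ^ 2) hb
  rw [inv_inv] at h3
  have h4 : Real.exp (-(2 * (8 * S)⁻¹) * ‖z‖ ^ 2) ≤ Real.exp (-(8 * S)⁻¹ * ‖z‖ ^ 2) := by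
    gcongr
    linarith
  calc _ ≤ (1 + ‖z‖ ^ 2) * ((4 * Real.pi * s) ^ (-(3 / 2) : ℝ) *
        Real.exp (-(2 * (8 * S)⁻¹) * ‖z‖ ^ 2)) := by gcongr
    _ = (4 * Real.pi * s) ^ (-(3 / 2) : ℝ) * (Real.exp (-(2 * (8 * S)⁻¹) * ‖z‖ ^ 2) +
        ‖z‖ ^ 2 * Real.exp (-(2 * (8 * S)⁻¹) * ‖z‖ ^ 2)) := by ring
    _ ≤ (4 * Real.pi * s) ^ (-(3 / 2) : ℝ) * (Real.exp (-(8 * S)⁻¹ * ‖z‖ ^ 2) +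
        8 * S * Real.exp (-(8 * S)⁻¹ * ‖z‖ ^ 2)) := by gcongr
    _ = _ := by ring

lemma abs_heatKernelLap_le {t : ℝ} (ht : 0 < t) (z : E3) :
    |heatKernelLap t z| ≤ (1 / (4 * t ^ 2) + 3 / (2 * t)) * ((1 + ‖z‖ ^ 2) * heatKernel t z) := by
  unfold heatKernelLap
  rw [abs_mul, abs_of_pos (heatKernel_pos ht z), ← mul_assoc]
  refine mul_le_mul_of_nonneg_right ?_ (heatKernel_pos ht z).le
  refine (abs_sub _ _).trans ?_
  rw [abs_of_nonneg (by positivity), abs_of_nonneg (by positivity)]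
  have h1 : 0 < 1 / (4 * t ^ 2) := by positivity
  have h2 : 0 < 3 / (2 * t) := by positivity
  have h3 : ‖z‖ ^ 2 / (4 * t ^ 2) = ‖z‖ ^ 2 * (1 / (4 * t ^ 2)) := by ring
  nlinarith [mul_nonneg h2.le (sq_nonneg ‖z‖)]

lemma exists_heatKernelLap_le_exp {s S : ℝ} (hs : 0 < s) (hS : 0 < S) :
    ∃ K > 0, ∀ t ∈ Icc s S, ∀ z : E3,
      |heatKernelLap t z| ≤ K * Real.exp (-(8 * S)⁻¹ * ‖z‖ ^ 2) := by
  obtain ⟨K, hK, h⟩ := exists_heatKernel_le_exp hs hS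
  refine ⟨(1 / (4 * s ^ 2) + 3 / (2 * s)) * K, by positivity, fun t ht z => ?_⟩
  have htp : 0 < t := hs.trans_le ht.1
  have hst := ht.1
  refine (abs_heatKernelLap_le htp z).trans ?_
  rw [mul_assoc]
  refine mul_le_mul ?_ (h t ht z) ?_ (by positivity)
  · gcongr
  · have := heatKernel_pos htp z
    positivity

lemma heatKernel_le_one_add {t : ℝ} (ht : 0 < t) (z : E3) :
    heatKernel t z ≤ (1 + ‖z‖ ^ 2) * heatKernel t z :=
  le_mul_of_one_le_left (heatKernel_pos ht z).le (by nlinarith [sq_nonneg ‖z‖])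

lemma hasDerivAt_heatKernel_time {t : ℝ} (ht : 0 < t) (z : E3) :
    HasDerivAt (fun s => heatKernel s z) (heatKernelLap t z) t := by
  have h1 : HasDerivAt (fun s : ℝ => 4 * Real.pi * s) (4 * Real.pi) t := by
    simpa using (hasDerivAt_id t).const_mul (4 * Real.pi)
  have h2 := h1.rpow_const (p := (-(3 / 2) : ℝ)) (Or.inl (by positivity))
  have h3 : HasDerivAt (fun s : ℝ => -(‖z‖ ^ 2) / (4 * s)) (‖z‖ ^ 2 / (4 * t ^ 2)) t := by
    have h4 : HasDerivAt (fun s : ℝ => 4 * s) 4 t := by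
      simpa using (hasDerivAt_id t).const_mul 4
    refine ((hasDerivAt_const t (-(‖z‖ ^ 2))).div h4 (by positivity)).congr_deriv ?_
    field_simp
    ring
  refine (h2.mul h3.exp).congr_deriv ?_
  unfold heatKernelLap heatKernel
  rw [Real.rpow_sub_one (by positivity)]
  field_simp
  ring

lemma contDiff_heatKernel (t : ℝ) : ContDiff ℝ ∞ (heatKernel t) := by
  unfold heatKernel
  exact contDiff_const.mul (((contDiff_norm_sq ℝ).neg.div_const _).exp)

lemma hasFDerivAt_heatKernel (t : ℝ) (z : E3) :
    HasFDerivAt (heatKernel t) ((-(heatKernel t z / (2 * t))) • innerSL ℝ z) z := by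
  have h := (((hasStrictFDerivAt_norm_sq z).hasFDerivAt.const_mul
    (-(4 * t)⁻¹)).exp).const_mul ((4 * Real.pi * t) ^ (-(3 / 2) : ℝ))
  have h' : HasFDerivAt (heatKernel t) _ z :=
    h.congr_of_eventuallyEq (Eventually.of_forall fun z => heatKernel_eq z)
  refine h'.congr_fderiv ?_
  rw [heatKernel_eq]
  ext v
  simp
  ring

lemma fderiv_heatKernel_single (t : ℝ) (z : E3) (i : Fin 3) :
    fderiv ℝ (heatKernel t) z (EuclideanSpace.single i 1) = -(z i / (2 * t)) * heatKernel t z := by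
  rw [(hasFDerivAt_heatKernel t z).fderiv]
  simp [EuclideanSpace.inner_single_right]
  ring

lemma fderiv_fderiv_heatKernel_single (t : ℝ) (z : E3) (i : Fin 3) :
    fderiv ℝ (fun y => fderiv ℝ (heatKernel t) y (EuclideanSpace.single i 1)) z
        (EuclideanSpace.single i 1) =
      ((z i) ^ 2 / (4 * t ^ 2) - 1 / (2 * t)) * heatKernel t z := by
  simp_rw [fderiv_heatKernel_single]
  have h1 : HasFDerivAt (fun y : E3 => -(y i / (2 * t)))
      ((-(2 * t)⁻¹) • (EuclideanSpace.proj i : E3 →L[ℝ] ℝ)) z := by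
    have := ((EuclideanSpace.proj i : E3 →L[ℝ] ℝ).hasFDerivAt
      (x := z)).const_smul (-(2 * t)⁻¹)
    refine this.congr_of_eventuallyEq (Eventually.of_forall fun y => ?_)
    simp [div_eq_inv_mul]
  rw [(h1.fun_mul (hasFDerivAt_heatKernel t z)).fderiv]
  simp [EuclideanSpace.inner_single_right]
  -- At `t = 0` the divisions by zero make both sides vanish.
  by_cases ht : t = 0
  · simp [ht]
  · field_simp
    ring

/-! ### Laplacian, cutoffs, and admissibility of the heat kernel as a test function -/

lemma two_le_smooth : (2 : WithTop ℕ∞) ≤ ((⊤ : ℕ∞) : WithTop ℕ∞) := by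
  exact WithTop.coe_le_coe.2 (le_top : (2 : ℕ∞) ≤ ⊤)

/-- The partial derivative in the direction of the `i`-th coordinate. -/
def partialDeriv (i : Fin 3) (f : E3 → ℝ) (x : E3) : ℝ :=
  fderiv ℝ f x (EuclideanSpace.single i 1)

lemma contDiff_partialDeriv {f : E3 → ℝ} {m n : WithTop ℕ∞} (hf : ContDiff ℝ n f)
    (hmn : m + 1 ≤ n) (i : Fin 3) : ContDiff ℝ m (partialDeriv i f) :=
  (hf.fderiv_right hmn).clm_apply contDiff_const

lemma laplacian_eq_sum_partialDeriv {f : E3 → ℝ} (hf : ContDiff ℝ 2 f) (x : E3) :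
    Laplacian.laplacian f x = ∑ i, partialDeriv i (partialDeriv i f) x := by
  rw [InnerProductSpace.laplacian_eq_iteratedFDeriv_orthonormalBasis f
    (EuclideanSpace.basisFun (Fin 3) ℝ)]
  refine Finset.sum_congr rfl fun i _ => ?_
  have hd : DifferentiableAt ℝ (fderiv ℝ f) x :=
    (hf.fderiv_right (m := 1) (by norm_num)).differentiable (by norm_num) x
  rw [iteratedFDeriv_two_apply]
  unfold partialDeriv
  rw [fderiv_clm_apply hd (differentiableAt_const _)]
  simp

lemma continuous_laplacian {f : E3 → ℝ} (hf : ContDiff ℝ 2 f) :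
    Continuous (Laplacian.laplacian f) := by
  rw [funext (laplacian_eq_sum_partialDeriv hf)]
  refine continuous_finsetSum _ fun i _ => ?_
  have h1 : ContDiff ℝ 1 (partialDeriv i f) := contDiff_partialDeriv hf (by norm_num) i
  exact (contDiff_partialDeriv (m := 0) h1 (by norm_num) i).continuous

lemma partialDeriv_mul {f g : E3 → ℝ} {x : E3} (hf : DifferentiableAt ℝ f x)
    (hg : DifferentiableAt ℝ g x) (i : Fin 3) :
    partialDeriv i (fun y => f y * g y) x =
      f x * partialDeriv i g x + g x * partialDeriv i f x := by
  unfold partialDeriv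
  rw [fderiv_fun_mul hf hg]
  simp

lemma laplacian_mul {f g : E3 → ℝ} (hf : ContDiff ℝ 2 f) (hg : ContDiff ℝ 2 g) (x : E3) :
    Laplacian.laplacian (fun y => f y * g y) x =
      f x * Laplacian.laplacian g x + 2 * ∑ i, partialDeriv i f x * partialDeriv i g x +
        g x * Laplacian.laplacian f x := by
  have hf1 := hf.differentiable (by norm_num)
  have hg1 := hg.differentiable (by norm_num)
  rw [laplacian_eq_sum_partialDeriv (hf.mul hg), laplacian_eq_sum_partialDeriv hf,
    laplacian_eq_sum_partialDeriv hg, Finset.mul_sum, Finset.mul_sum, Finset.mul_sum,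
    ← Finset.sum_add_distrib, ← Finset.sum_add_distrib]
  refine Finset.sum_congr rfl fun i _ => ?_
  have hf2 : Differentiable ℝ (partialDeriv i f) :=
    (contDiff_partialDeriv (m := 1) hf (by norm_num) i).differentiable (by norm_num)
  have hg2 : Differentiable ℝ (partialDeriv i g) :=
    (contDiff_partialDeriv (m := 1) hg (by norm_num) i).differentiable (by norm_num)
  have h : partialDeriv i (fun y => f y * g y) =
      fun y => f y * partialDeriv i g y + g y * partialDeriv i f y :=
    funext fun y => partialDeriv_mul (hf1 y) (hg1 y) i
  rw [h]
  have h2 : partialDeriv i (fun y => f y * partialDeriv i g y + g y * partialDeriv i f y) x =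
      partialDeriv i (fun y => f y * partialDeriv i g y) x +
        partialDeriv i (fun y => g y * partialDeriv i f y) x := by
    conv_lhs => unfold partialDeriv
    have := fderiv_fun_add ((hf1 x).mul (hg2 x)) ((hg1 x).mul (hf2 x))
    exact congrArg (fun l : E3 →L[ℝ] ℝ => l (EuclideanSpace.single i 1)) this
  rw [h2, partialDeriv_mul (hf1 x) (hg2 x), partialDeriv_mul (hg1 x) (hf2 x)]
  ring

lemma partialDeriv_comp_smul (r : ℝ) (f : E3 → ℝ) (i : Fin 3) :
    partialDeriv i (fun y => f (r • y)) = fun y => r * partialDeriv i f (r • y) := by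
  ext y
  unfold partialDeriv
  rw [fderiv_comp_smul]
  simp

lemma hasCompactSupport_partialDeriv {f : E3 → ℝ} (hf : HasCompactSupport f) (i : Fin 3) :
    HasCompactSupport (partialDeriv i f) :=
  (hf.fderiv (𝕜 := ℝ)).comp_left (g := fun l : E3 →L[ℝ] ℝ => l (EuclideanSpace.single i 1)) rfl

/-- The cutoffs are dilations `χ (r y)` of one bump with `r = 1/(n+1)`. Each derivative produces a
factor `r ≤ 1`, so all bounds are uniform in `n`, while the region where the cutoff equals `1`
exhausts the space. -/
lemma exists_cutoff : ∃ (M : ℝ) (χ : ℕ → E3 → ℝ), 0 ≤ M ∧ (∀ n, IsTest (χ n)) ∧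
    (∀ n y, |χ n y| ≤ M) ∧ (∀ n i y, |partialDeriv i (χ n) y| ≤ M) ∧
    (∀ n y, |Laplacian.laplacian (χ n) y| ≤ M) ∧ ∀ y, ∀ᶠ n in atTop, χ n =ᶠ[𝓝 y] 1 := by
  let χ : ContDiffBump (0 : E3) := ⟨1, 2, one_pos, one_lt_two⟩
  have hχ : ContDiff ℝ ∞ χ := χ.contDiff
  have hχc : HasCompactSupport χ := χ.hasCompactSupport
  have hχ1 : ∀ i, ContDiff ℝ ∞ (partialDeriv i χ) := fun i =>
    contDiff_partialDeriv hχ (by simp) i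
  have hχ2 : ∀ i, ContDiff ℝ ∞ (partialDeriv i (partialDeriv i χ)) := fun i =>
    contDiff_partialDeriv (hχ1 i) (by simp) i
  obtain ⟨M0, h0⟩ := hχc.exists_bound_of_continuous hχ.continuous
  choose M1 h1 using fun i =>
    (hasCompactSupport_partialDeriv hχc i).exists_bound_of_continuous (hχ1 i).continuous
  choose M2 h2 using fun i =>
    (hasCompactSupport_partialDeriv (hasCompactSupport_partialDeriv hχc i)
      i).exists_bound_of_continuous (hχ2 i).continuous
  have hM0 : 0 ≤ M0 := (norm_nonneg _).trans (h0 0)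
  have hM1 : ∀ i, 0 ≤ M1 i := fun i => (norm_nonneg _).trans (h1 i 0)
  have hM2 : ∀ i, 0 ≤ M2 i := fun i => (norm_nonneg _).trans (h2 i 0)
  have hS1 : 0 ≤ ∑ i, M1 i := Finset.sum_nonneg fun i _ => hM1 i
  have hS2 : 0 ≤ ∑ i, M2 i := Finset.sum_nonneg fun i _ => hM2 i
  let r : ℕ → ℝ := fun n => ((n : ℝ) + 1)⁻¹
  have hr0 : ∀ n, 0 < r n := fun n => by positivity
  have hr1 : ∀ n, r n ≤ 1 := fun n => inv_le_one_of_one_le₀ (by simp)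
  have hC : ∀ n, ContDiff ℝ ∞ fun y => χ (r n • y) := fun n =>
    hχ.comp (contDiff_const_smul (r n))
  have hmul : ∀ n (a : ℝ), |r n * a| ≤ |a| := fun n a => by
    rw [abs_mul, abs_of_pos (hr0 n)]
    exact mul_le_of_le_one_left (abs_nonneg _) (hr1 n)
  refine ⟨M0 + ∑ i, M1 i + ∑ i, M2 i, fun n y => χ (r n • y), by positivity,
    fun n => ⟨hC n, ?_⟩, fun n y => ?_, fun n i y => ?_, fun n y => ?_, fun y => ?_⟩
  · exact hχc.comp_homeomorph (Homeomorph.smulOfNeZero (r n) (hr0 n).ne')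
  · have := h0 (r n • y)
    rw [Real.norm_eq_abs] at this
    linarith
  · rw [partialDeriv_comp_smul]
    have h := h1 i (r n • y)
    have h' := Finset.single_le_sum (fun i _ => hM1 i) (Finset.mem_univ i)
    rw [Real.norm_eq_abs] at h
    have := hmul n (partialDeriv i χ (r n • y))
    simp only at this ⊢
    linarith
  · rw [laplacian_eq_sum_partialDeriv ((hC n).of_le two_le_smooth)]
    have : |∑ i, partialDeriv i (partialDeriv i fun y => χ (r n • y)) y| ≤ ∑ i, M2 i := by
      refine (Finset.abs_sum_le_sum_abs _ _).trans (Finset.sum_le_sum fun i _ => ?_)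
      rw [partialDeriv_comp_smul]
      have e : partialDeriv i (fun y => r n * partialDeriv i χ (r n • y)) y =
          r n * (r n * partialDeriv i (partialDeriv i χ) (r n • y)) := by
        have e1 : partialDeriv i (fun y => r n * partialDeriv i χ (r n • y)) y =
            r n * partialDeriv i (fun y => partialDeriv i χ (r n • y)) y := by
          conv_lhs => unfold partialDeriv
          conv_rhs => unfold partialDeriv
          rw [fderiv_const_mul]
          · rfl
          · exact ((hχ1 i).differentiable (by simp)).comp (differentiable_id.const_smul (r n)) y
        rw [e1, partialDeriv_comp_smul]
      rw [e]
      exact (hmul n _).trans ((hmul n _).trans (h2 i _))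
    linarith
  · have ht : Tendsto (fun n : ℕ => r n * (‖y‖ + 1)) atTop (𝓝 0) := by
      have : Tendsto r atTop (𝓝 0) := by
        simpa [r, one_div] using tendsto_one_div_add_atTop_nhds_zero_nat (𝕜 := ℝ)
      simpa using this.mul_const (‖y‖ + 1)
    filter_upwards [ht.eventually_lt_const one_pos] with n hn
    filter_upwards [Metric.ball_mem_nhds y one_pos] with z hz
    refine χ.one_of_mem_closedBall ?_
    rw [mem_closedBall_zero_iff, norm_smul, Real.norm_of_nonneg (hr0 n).le]
    have : ‖z‖ ≤ ‖y‖ + 1 := by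
      have := norm_le_norm_add_norm_sub' z y
      rw [mem_ball_iff_norm] at hz
      linarith
    exact (mul_le_mul_of_nonneg_left this (hr0 n).le).trans hn.le

lemma heatKernel_sub_comm (t : ℝ) (x y : E3) : heatKernel t (x - y) = heatKernel t (y - x) := by
  unfold heatKernel
  rw [norm_sub_rev]

lemma partialDeriv_heatKernel_sub (t : ℝ) (x y : E3) (i : Fin 3) :
    partialDeriv i (fun y => heatKernel t (x - y)) y =
      -((y - x) i / (2 * t)) * heatKernel t (x - y) := by
  rw [heatKernel_sub_comm t x y, ← fderiv_heatKernel_single]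
  simp_rw [heatKernel_sub_comm t x]
  unfold partialDeriv
  rw [fderiv_comp_sub (f := heatKernel t)]

lemma contDiff_heatKernel_sub (t : ℝ) (x : E3) : ContDiff ℝ ∞ fun y => heatKernel t (x - y) :=
  (contDiff_heatKernel t).comp (contDiff_const.sub contDiff_id)

lemma laplacian_heatKernel_sub (t : ℝ) (x y : E3) :
    Laplacian.laplacian (fun y => heatKernel t (x - y)) y = heatKernelLap t (x - y) := by
  rw [laplacian_eq_sum_partialDeriv ((contDiff_heatKernel_sub t x).of_le
    two_le_smooth)]
  have h : ∀ i, partialDeriv i (partialDeriv i fun y => heatKernel t (x - y)) y =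
      (((y - x) i) ^ 2 / (4 * t ^ 2) - 1 / (2 * t)) * heatKernel t (x - y) := fun i => by
    rw [heatKernel_sub_comm t x y, ← fderiv_fderiv_heatKernel_single]
    simp_rw [heatKernel_sub_comm t x]
    unfold partialDeriv
    simp_rw [fderiv_comp_sub (f := heatKernel t)]
    rw [fderiv_comp_sub (f := fun z => fderiv ℝ (heatKernel t) z (EuclideanSpace.single i 1))]
  simp_rw [h]
  unfold heatKernelLap
  rw [← Finset.sum_mul, norm_sub_rev, EuclideanSpace.norm_sq_eq, Fin.sum_univ_three,
    Fin.sum_univ_three]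
  simp only [Real.norm_eq_abs, sq_abs]
  ring

lemma abs_partialDeriv_heatKernel_sub_le {t : ℝ} (ht : 0 < t) (x y : E3) (i : Fin 3) :
    |partialDeriv i (fun y => heatKernel t (x - y)) y| ≤
      (2 * t)⁻¹ * ((1 + ‖x - y‖ ^ 2) * heatKernel t (x - y)) := by
  rw [partialDeriv_heatKernel_sub, abs_mul, abs_of_pos (heatKernel_pos ht _), ← mul_assoc, abs_neg,
    abs_div, abs_of_pos (show 0 < 2 * t by positivity), div_eq_inv_mul]
  refine mul_le_mul_of_nonneg_right ?_ (heatKernel_pos ht _).le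
  refine mul_le_mul_of_nonneg_left ?_ (by positivity)
  have h : |(y - x) i| ≤ ‖x - y‖ := by
    rw [norm_sub_rev]
    exact PiLp.norm_apply_le (y - x) i
  nlinarith [sq_nonneg (‖x - y‖ - 1), norm_nonneg (x - y)]

/-- The heat kernel is a dominated limit, together with its Laplacian, of test functions. -/
lemma exists_test_tendsto_heatKernel {t : ℝ} (ht : 0 < t) (x : E3) :
    ∃ (φ : ℕ → E3 → ℝ) (B : E3 → ℝ), (∀ n, IsTest (φ n)) ∧ Integrable B ∧
      (∀ n y, |φ n y| ≤ B y) ∧ (∀ n y, |Laplacian.laplacian (φ n) y| ≤ B y) ∧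
      (∀ y, Tendsto (fun n => φ n y) atTop (𝓝 (heatKernel t (x - y)))) ∧
      ∀ y, Tendsto (fun n => Laplacian.laplacian (φ n) y) atTop (𝓝 (heatKernelLap t (x - y))) := by
  obtain ⟨M, χ, hM, hχ, hχ0, hχ1, hχ2, hχe⟩ := exists_cutoff
  set k := 1 / (4 * t ^ 2) + 3 / (2 * t) with hk
  have hk0 : 0 < k := by positivity
  set G : E3 → ℝ := fun z => (1 + ‖z‖ ^ 2) * heatKernel t z with hG
  have hGi : Integrable G := by
    have := (integrable_heatKernel ht).add (integrable_sq_norm_mul_heatKernel ht)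
    refine this.congr (Eventually.of_forall fun z => ?_)
    simp [hG]
    ring
  have hgG : ∀ z, heatKernel t z ≤ G z := heatKernel_le_one_add ht
  have hG0 : ∀ z, 0 ≤ G z := fun z => (heatKernel_pos ht z).le.trans (hgG z)
  have hg2 : ContDiff ℝ 2 fun y => heatKernel t (x - y) :=
    (contDiff_heatKernel_sub t x).of_le two_le_smooth
  have hlap : ∀ n y, Laplacian.laplacian (fun y => χ n y * heatKernel t (x - y)) y = _ := fun n y =>
    laplacian_mul ((hχ n).1.of_le two_le_smooth) hg2 y
  -- The three terms of the dominating constant correspond to those of the product rule for the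
  -- Laplacian: `χ Δg`, `2 ∇χ · ∇g` (three coordinates) and `g Δχ`.
  refine ⟨fun n y => χ n y * heatKernel t (x - y),
    fun y => (M * k + 2 * (3 * (M * (2 * t)⁻¹)) + M) * G (x - y),
    fun n => ⟨(hχ n).1.mul (contDiff_heatKernel_sub t x), (hχ n).2.mul_right⟩,
    (hGi.comp_sub_left x).const_mul _, fun n y => ?_, fun n y => ?_, fun y => ?_, fun y => ?_⟩
  · rw [abs_mul, abs_of_pos (heatKernel_pos ht _)]
    have h1 : |χ n y| * heatKernel t (x - y) ≤ M * G (x - y) :=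
      mul_le_mul (hχ0 n y) (hgG _) (heatKernel_pos ht _).le hM
    have h2 : 0 ≤ (M * k + 2 * (3 * (M * (2 * t)⁻¹))) * G (x - y) :=
      mul_nonneg (by positivity) (hG0 _)
    linarith
  · rw [hlap, laplacian_heatKernel_sub]
    have h1 : |χ n y * heatKernelLap t (x - y)| ≤ M * (k * G (x - y)) := by
      rw [abs_mul]
      exact mul_le_mul (hχ0 n y) (abs_heatKernelLap_le ht _) (abs_nonneg _) hM
    have h2 : |∑ i, partialDeriv i (χ n) y * partialDeriv i (fun y => heatKernel t (x - y)) y| ≤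
        3 * (M * ((2 * t)⁻¹ * G (x - y))) := by
      refine (Finset.abs_sum_le_sum_abs _ _).trans ?_
      refine (Finset.sum_le_card_nsmul _ _ (M * ((2 * t)⁻¹ * G (x - y))) fun i _ => ?_).trans ?_
      · rw [abs_mul]
        exact mul_le_mul (hχ1 n i y) (abs_partialDeriv_heatKernel_sub_le ht x y i)
          (abs_nonneg _) hM
      · simp
    have h3 : |heatKernel t (x - y) * Laplacian.laplacian (χ n) y| ≤ M * G (x - y) := by
      rw [abs_mul, abs_of_pos (heatKernel_pos ht _), mul_comm]
      exact mul_le_mul (hχ2 n y) (hgG _) (heatKernel_pos ht _).le hM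
    refine (abs_add_three _ _ _).trans ?_
    rw [abs_mul 2, abs_two]
    linarith
  -- Both sequences are eventually constant at each point, the cutoff being eventually `1` near `y`.
  · refine tendsto_const_nhds.congr' ?_
    filter_upwards [hχe y] with n hn
    rw [hn.eq_of_nhds]
    simp
  · refine tendsto_const_nhds.congr' ?_
    filter_upwards [hχe y] with n hn
    have : (fun y => χ n y * heatKernel t (x - y)) =ᶠ[𝓝 y] fun y => heatKernel t (x - y) := by
      filter_upwards [hn] with z hz
      rw [hz]
      simp
    rw [(InnerProductSpace.laplacian_congr_nhds this).eq_of_nhds, laplacian_heatKernel_sub]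

/-! ### Duhamel's formula in differential form -/

section

variable {V : Type*} [NormedAddCommGroup V] [NormedSpace ℝ V]

/-- The heat semigroup on vector-valued fields. -/
def heatConv (t : ℝ) (u : E3 → V) (x : E3) : V := ∫ y, heatKernel t (x - y) • u y

/-- The convolution with the Laplacian of the heat kernel. -/
def heatConvLap (t : ℝ) (u : E3 → V) (x : E3) : V := ∫ y, heatKernelLap t (x - y) • u y

/-- `q` is a bounded continuous weak solution of `q_t = c Δq + F` on `[0,T]`, where `F` is bounded
and continuous. -/
structure IsBoundedWeakSolution (c T M : ℝ) (q F : ℝ → E3 → V) : Prop where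
  cont : Continuous fun p : ℝ × E3 => q p.1 p.2
  cont_source : Continuous fun p : ℝ × E3 => F p.1 p.2
  bound : ∀ s y, ‖q s y‖ ≤ M
  bound_source : ∀ s y, ‖F s y‖ ≤ M
  equation : ∀ t ∈ Icc 0 T, ∀ φ : E3 → ℝ, IsTest φ →
    ∫ x, φ x • q t x = (∫ x, φ x • q 0 x) +
      ∫ s in (0 : ℝ)..t, ∫ x, ((c * Laplacian.laplacian φ x) • q s x + φ x • F s x)

lemma tendsto_integral_smul_of_abs_le {φ : ℕ → E3 → ℝ} {ψ B : E3 → ℝ} {u : E3 → V} {M : ℝ}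
    (hφ : ∀ n, Continuous (φ n)) (hu : Continuous u) (hM : ∀ y, ‖u y‖ ≤ M) (hB : Integrable B)
    (hφB : ∀ n y, |φ n y| ≤ B y) (hφψ : ∀ y, Tendsto (fun n => φ n y) atTop (𝓝 (ψ y))) :
    Tendsto (fun n => ∫ y, φ n y • u y) atTop (𝓝 (∫ y, ψ y • u y)) := by
  refine tendsto_integral_filter_of_dominated_convergence (fun y => B y * M)
    (Eventually.of_forall fun n => ((hφ n).smul hu).aestronglyMeasurable)
    (Eventually.of_forall fun n => Eventually.of_forall fun y => ?_) (hB.mul_const M)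
    (Eventually.of_forall fun y => (hφψ y).smul_const _)
  rw [norm_smul, Real.norm_eq_abs]
  exact mul_le_mul (hφB n y) (hM y) (norm_nonneg _) ((abs_nonneg _).trans (hφB n y))

lemma integrable_smul_of_bound {φ : E3 → ℝ} {u : E3 → V} {M : ℝ} (hφ : Integrable φ)
    (hu : AEStronglyMeasurable u) (hM : ∀ y, ‖u y‖ ≤ M) : Integrable fun y => φ y • u y :=
  hφ.smul_bdd M hu (Eventually.of_forall hM)

lemma IsTest.integrable {φ : E3 → ℝ} (hφ : IsTest φ) : Integrable φ :=
  hφ.1.continuous.integrable_of_hasCompactSupport hφ.2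

/-- The weak equation tested with `heatKernel σ (x - ·)`. This function is not compactly supported,
so the identity is a dominated limit along truncations; boundedness of `q` and `F` provides the
domination in space and in time. -/
lemma IsBoundedWeakSolution.heatConv_eq {c T M : ℝ} {q F : ℝ → E3 → V}
    (h : IsBoundedWeakSolution c T M q F) {σ t : ℝ} (hσ : 0 < σ) (ht : t ∈ Icc 0 T) (x : E3) :
    heatConv σ (q t) x = heatConv σ (q 0) x +
      ∫ s in (0 : ℝ)..t, (c • heatConvLap σ (q s) x + heatConv σ (F s) x) := by
  obtain ⟨φ, B, hφ, hB, hφB, hΔB, hφt, hΔt⟩ := exists_test_tendsto_heatKernel hσ x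
  have hq : ∀ s, Continuous (q s) := fun s => h.cont.comp (Continuous.prodMk_right s)
  have hF : ∀ s, Continuous (F s) := fun s => h.cont_source.comp (Continuous.prodMk_right s)
  have hΔc : ∀ n, Continuous (Laplacian.laplacian (φ n)) := fun n =>
    continuous_laplacian ((hφ n).1.of_le two_le_smooth)
  have hφc : ∀ n, Continuous (φ n) := fun n => (hφ n).1.continuous
  have hlim : ∀ s, Tendsto (fun n => ∫ y, φ n y • q s y) atTop (𝓝 (heatConv σ (q s) x)) :=
    fun s => tendsto_integral_smul_of_abs_le hφc (hq s) (h.bound s) hB hφB hφt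
  have hlimF : ∀ s, Tendsto (fun n => ∫ y, φ n y • F s y) atTop (𝓝 (heatConv σ (F s) x)) :=
    fun s => tendsto_integral_smul_of_abs_le hφc (hF s) (h.bound_source s) hB hφB hφt
  have hlimΔ : ∀ s, Tendsto (fun n => ∫ y, Laplacian.laplacian (φ n) y • q s y) atTop
      (𝓝 (heatConvLap σ (q s) x)) :=
    fun s => tendsto_integral_smul_of_abs_le hΔc (hq s) (h.bound s) hB hΔB hΔt
  have hint : ∀ n s, ∫ y, ((c * Laplacian.laplacian (φ n) y) • q s y + φ n y • F s y) =
      c • (∫ y, Laplacian.laplacian (φ n) y • q s y) + ∫ y, φ n y • F s y := fun n s => by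
    have hΔi : Integrable (Laplacian.laplacian (φ n)) :=
      hB.mono' (hΔc n).aestronglyMeasurable (Eventually.of_forall (hΔB n))
    have h1 := integrable_smul_of_bound hΔi (hq s).aestronglyMeasurable (h.bound s)
    have h2 := integrable_smul_of_bound (hφ n).integrable (hF s).aestronglyMeasurable
      (h.bound_source s)
    simp_rw [mul_smul]
    have h1' : Integrable fun y => c • (Laplacian.laplacian (φ n) y • q s y) := h1.smul c
    rw [integral_add h1' h2, integral_smul]
  refine tendsto_nhds_unique (hlim t) ?_
  simp_rw [h.equation t ht _ (hφ _)]
  refine (hlim 0).add ?_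
  refine intervalIntegral.tendsto_integral_filter_of_dominated_convergence
    (fun _ => |c| * (∫ y, B y * M) + ∫ y, B y * M)
    (Eventually.of_forall fun n => ?_) (Eventually.of_forall fun n => Eventually.of_forall
    fun s _ => ?_) intervalIntegrable_const (Eventually.of_forall fun s _ => ?_)
  · refine StronglyMeasurable.aestronglyMeasurable ?_
    refine StronglyMeasurable.integral_prod_right (f := fun s y =>
      (c * Laplacian.laplacian (φ n) y) • q s y + φ n y • F s y) ?_
    refine Continuous.stronglyMeasurable ?_
    refine Continuous.add (Continuous.smul ?_ h.cont) (Continuous.smul ?_ h.cont_source)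
    · exact continuous_const.mul ((hΔc n).comp continuous_snd)
    · exact (hφc n).comp continuous_snd
  · rw [hint]
    have hn : ∀ (ψ : E3 → ℝ) (u : E3 → V), (∀ y, |ψ y| ≤ B y) → (∀ y, ‖u y‖ ≤ M) →
        ‖∫ y, ψ y • u y‖ ≤ ∫ y, B y * M := fun ψ u h1 h2 => by
      refine norm_integral_le_of_norm_le (hB.mul_const M) (Eventually.of_forall fun y => ?_)
      rw [norm_smul, Real.norm_eq_abs]
      exact mul_le_mul (h1 y) (h2 y) (norm_nonneg _) ((abs_nonneg _).trans (h1 y))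
    refine (norm_add_le _ _).trans (add_le_add ?_ (hn _ _ (hφB n) (h.bound_source s)))
    rw [norm_smul, Real.norm_eq_abs]
    exact mul_le_mul_of_nonneg_left (hn _ _ (hΔB n) (h.bound s)) (abs_nonneg c)
  · simp_rw [hint]
    exact ((hlimΔ s).const_smul c).add (hlimF s)

/-- Joint continuity of the convolution with a family of kernels of Gaussian decay. -/
lemma continuousAt_integral_kernel_smul {k : ℝ → E3 → ℝ} {u : ℝ → E3 → V} {M : ℝ}
    (hk : ∀ σ, Continuous (k σ)) (hkt : ∀ z, ∀ σ > 0, ContinuousAt (fun r => k r z) σ)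
    (hkB : ∀ s S : ℝ, 0 < s → 0 < S → ∃ K > 0, ∀ t ∈ Icc s S, ∀ z : E3,
      |k t z| ≤ K * Real.exp (-(8 * S)⁻¹ * ‖z‖ ^ 2))
    (hu : Continuous fun p : ℝ × E3 => u p.1 p.2) (hM : ∀ s y, ‖u s y‖ ≤ M) (x : E3)
    (p : ℝ × ℝ) (hp : 0 < p.2) :
    ContinuousAt (fun r : ℝ × ℝ => ∫ y, k r.2 (x - y) • u r.1 y) p := by
  obtain ⟨K, -, hK⟩ := hkB (p.2 / 2) (2 * p.2) (by positivity) (by positivity)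
  have hus : ∀ s, Continuous (u s) := fun s => hu.comp (Continuous.prodMk_right s)
  refine continuousAt_of_dominated
    (bound := fun y => K * Real.exp (-(8 * (2 * p.2))⁻¹ * ‖x - y‖ ^ 2) * M)
    (Eventually.of_forall fun r => ?_) ?_ ?_ (Eventually.of_forall fun y => ?_)
  · exact (((hk _).comp (continuous_const.sub continuous_id)).smul
      (hus _)).aestronglyMeasurable
  · have : ∀ᶠ r : ℝ × ℝ in 𝓝 p, r.2 ∈ Icc (p.2 / 2) (2 * p.2) :=
      continuousAt_snd.eventually_mem (Icc_mem_nhds (by linarith) (by linarith))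
    filter_upwards [this] with r hr
    refine Eventually.of_forall fun y => ?_
    rw [norm_smul, Real.norm_eq_abs]
    exact mul_le_mul (hK _ hr _) (hM _ _) (norm_nonneg _)
      ((abs_nonneg _).trans (hK _ hr _))
  · exact (((integrable_exp_neg_mul_sq_norm (by positivity)).comp_sub_left x).const_mul
      K).mul_const M
  · refine ContinuousAt.smul ?_ ?_
    · exact (hkt (x - y) p.2 hp).comp (f := fun r : ℝ × ℝ => r.2) continuousAt_snd
    · exact (hu.comp (continuous_fst.prodMk continuous_const)).continuousAt

lemma continuousAt_heatKernelLap_time {σ : ℝ} (hσ : 0 < σ) (z : E3) :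
    ContinuousAt (fun r => heatKernelLap r z) σ := by
  unfold heatKernelLap
  refine ContinuousAt.mul ?_ (hasDerivAt_heatKernel_time hσ z).continuousAt
  have h1 : 4 * σ ^ 2 ≠ 0 := by positivity
  have h2 : 2 * σ ≠ 0 := by positivity
  fun_prop (disch := assumption)

lemma abs_heatKernel_le_exp (s S : ℝ) (hs : 0 < s) (hS : 0 < S) :
    ∃ K > 0, ∀ t ∈ Icc s S, ∀ z : E3,
      |heatKernel t z| ≤ K * Real.exp (-(8 * S)⁻¹ * ‖z‖ ^ 2) := by
  obtain ⟨K, hK, h⟩ := exists_heatKernel_le_exp hs hS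
  refine ⟨K, hK, fun t ht z => ?_⟩
  have htp := hs.trans_le ht.1
  rw [abs_of_pos (heatKernel_pos htp z)]
  exact (heatKernel_le_one_add htp z).trans (h t ht z)

lemma continuousAt_heatConv {u : ℝ → E3 → V} {M : ℝ}
    (hu : Continuous fun p : ℝ × E3 => u p.1 p.2) (hM : ∀ s y, ‖u s y‖ ≤ M) (x : E3)
    (p : ℝ × ℝ) (hp : 0 < p.2) :
    ContinuousAt (fun r : ℝ × ℝ => heatConv r.2 (u r.1) x) p :=
  continuousAt_integral_kernel_smul continuous_heatKernel
    (fun z _ hσ => (hasDerivAt_heatKernel_time hσ z).continuousAt) abs_heatKernel_le_exp hu hM x p hp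

lemma continuousAt_heatConvLap {u : ℝ → E3 → V} {M : ℝ}
    (hu : Continuous fun p : ℝ × E3 => u p.1 p.2) (hM : ∀ s y, ‖u s y‖ ≤ M) (x : E3)
    (p : ℝ × ℝ) (hp : 0 < p.2) :
    ContinuousAt (fun r : ℝ × ℝ => heatConvLap r.2 (u r.1) x) p :=
  continuousAt_integral_kernel_smul continuous_heatKernelLap
    (fun z _ hσ => continuousAt_heatKernelLap_time hσ z)
    (fun _ _ hs hS => exists_heatKernelLap_le_exp hs hS) hu hM x p hp

lemma hasDerivAt_heatConv_time {u : E3 → V} {M σ : ℝ} (hu : Continuous u)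
    (hM : ∀ y, ‖u y‖ ≤ M) (hσ : 0 < σ) (x : E3) :
    HasDerivAt (fun r => heatConv r u x) (heatConvLap σ u x) σ := by
  obtain ⟨K, -, hK⟩ := exists_heatKernelLap_le_exp (s := σ / 2) (S := 2 * σ) (by positivity)
    (by positivity)
  have hIcc : Icc (σ / 2) (2 * σ) ∈ 𝓝 σ := Icc_mem_nhds (by linarith) (by linarith)
  have hpos : ∀ r ∈ Icc (σ / 2) (2 * σ), 0 < r := fun r hr => by linarith [hr.1]
  refine (hasDerivAt_integral_of_dominated_loc_of_deriv_le
    (F := fun r y => heatKernel r (x - y) • u y)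
    (F' := fun r y => heatKernelLap r (x - y) • u y)
    (bound := fun y => K * Real.exp (-(8 * (2 * σ))⁻¹ * ‖x - y‖ ^ 2) * M) hIcc
    (Eventually.of_forall fun r => ?_) ?_ ?_ (Eventually.of_forall fun y r hr => ?_) ?_
    (Eventually.of_forall fun y r hr => ?_)).2
  · exact (((continuous_heatKernel r).comp (continuous_const.sub continuous_id)).smul
      hu).aestronglyMeasurable
  · exact integrable_smul_of_bound ((integrable_heatKernel hσ).comp_sub_left x)
      hu.aestronglyMeasurable hM
  · exact (((continuous_heatKernelLap σ).comp (continuous_const.sub continuous_id)).smul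
      hu).aestronglyMeasurable
  · rw [norm_smul, Real.norm_eq_abs]
    exact mul_le_mul (hK _ hr _) (hM _) (norm_nonneg _) ((abs_nonneg _).trans (hK _ hr _))
  · exact (((integrable_exp_neg_mul_sq_norm (by positivity)).comp_sub_left x).const_mul
      K).mul_const M
  · exact (hasDerivAt_heatKernel_time (hpos r hr) (x - y)).smul_const (u y)

/-- The integrand in `heatConv_eq` is continuous in time, so the fundamental theorem of calculus
applies. Mollification at fixed `σ` thus turns the weak equation into a classical one. -/
lemma IsBoundedWeakSolution.hasDerivAt_heatConv_const [CompleteSpace V] {c T M : ℝ}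
    {q F : ℝ → E3 → V}
    (h : IsBoundedWeakSolution c T M q F) {σ s : ℝ} (hσ : 0 < σ) (hs : s ∈ Ioo 0 T) (x : E3) :
    HasDerivAt (fun r => heatConv σ (q r) x)
      (c • heatConvLap σ (q s) x + heatConv σ (F s) x) s := by
  have hcont : Continuous fun r => c • heatConvLap σ (q r) x + heatConv σ (F r) x := by
    refine continuous_iff_continuousAt.2 fun r => ?_
    have hg : ContinuousAt (fun r : ℝ => (r, σ)) r := by fun_prop
    refine ContinuousAt.add (ContinuousAt.const_smul ?_ c) ?_
    · exact (continuousAt_heatConvLap h.cont h.bound x (r, σ) hσ).comp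
        (f := fun r : ℝ => (r, σ)) (x := r) hg
    · exact (continuousAt_heatConv h.cont_source h.bound_source x (r, σ) hσ).comp
        (f := fun r : ℝ => (r, σ)) (x := r) hg
  have hd := (intervalIntegral.integral_hasDerivAt_right (hcont.intervalIntegrable 0 s)
    (hcont.stronglyMeasurableAtFilter _ _) hcont.continuousAt).const_add (heatConv σ (q 0) x)
  refine hd.congr_of_eventuallyEq ?_
  filter_upwards [Ioo_mem_nhds hs.1 hs.2] with r hr
  exact h.heatConv_eq hσ ⟨hr.1.le, hr.2.le⟩ x

/-- Along the backward heat flow only the source term survives. -/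
lemma IsBoundedWeakSolution.hasDerivAt_heatConv [CompleteSpace V] {c T M : ℝ} {q F : ℝ → E3 → V}
    (h : IsBoundedWeakSolution c T M q F) {S s : ℝ} (hS : 0 < S - c * s) (hs : s ∈ Ioo 0 T)
    (x : E3) :
    HasDerivAt (fun r => heatConv (S - c * r) (q r) x) (heatConv (S - c * s) (F s) x) s := by
  let K : ℝ → ℝ → V := fun r σ => heatConv σ (q r) x
  let K₁ : ℝ → ℝ → V := fun r σ => c • heatConvLap σ (q r) x + heatConv σ (F r) x
  let K₂ : ℝ → ℝ → V := fun r σ => heatConvLap σ (q r) x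
  have hnear : ∀ᶠ v : ℝ × ℝ in 𝓝 (s, S - c * s), v.1 ∈ Ioo 0 T ∧ v.2 ∈ Ioi 0 :=
    prod_mem_nhds (Ioo_mem_nhds hs.1 hs.2) (Ioi_mem_nhds hS)
  have hq : ∀ s, Continuous (q s) := fun s => h.cont.comp (Continuous.prodMk_right s)
  -- Chain rule along `r ↦ (r, S - c r)`: both partial derivatives exist nearby and are continuous
  -- at the point. The first contributes `c • heatConvLap`, the second `-c • heatConvLap`, and these
  -- cancel.
  have hK := hasStrictFDerivAt_uncurry_coprod (u := (s, S - c * s)) (f := K)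
      (f₁ := fun r σ => ContinuousLinearMap.toSpanSingleton ℝ (K₁ r σ))
      (f₂ := fun r σ => ContinuousLinearMap.toSpanSingleton ℝ (K₂ r σ))
      (hnear.mono fun v hv => (h.hasDerivAt_heatConv_const hv.2 hv.1 x).hasFDerivAt)
      (hnear.mono fun v hv =>
        (hasDerivAt_heatConv_time (hq v.1) (h.bound v.1) hv.2 x).hasFDerivAt)
      ((ContinuousLinearMap.toSpanSingletonCLE (𝕜 := ℝ) (E := V)).continuous.continuousAt.comp
        (((continuousAt_heatConvLap h.cont h.bound x _ hS).const_smul c).add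
          (continuousAt_heatConv h.cont_source h.bound_source x _ hS)))
      ((ContinuousLinearMap.toSpanSingletonCLE (𝕜 := ℝ) (E := V)).continuous.continuousAt.comp
        (continuousAt_heatConvLap h.cont h.bound x _ hS))
  have hγ : HasDerivAt (fun r : ℝ => (r, S - c * r)) (1, -c) s := by
    refine (hasDerivAt_id s).prodMk ?_
    simpa using ((hasDerivAt_id s).const_mul c).const_sub S
  refine (hK.hasFDerivAt.comp_hasDerivAt s hγ).congr_deriv ?_
  simp [K₁, K₂, Function.HasUncurry.uncurry]

end

/-! ### Estimates for the heat semigroup -/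

section

variable {V : Type*} [NormedAddCommGroup V] [NormedSpace ℝ V]

lemma integrable_heatKernel_smul {t M : ℝ} (ht : 0 < t) {u : E3 → V}
    (hu : AEStronglyMeasurable u) (hM : ∀ y, ‖u y‖ ≤ M) (x : E3) :
    Integrable fun y => heatKernel t (x - y) • u y :=
  integrable_smul_of_bound ((integrable_heatKernel ht).comp_sub_left x) hu hM

lemma integral_heatKernel_sub {t : ℝ} (ht : 0 < t) (x : E3) : ∫ y, heatKernel t (x - y) = 1 := by
  rw [integral_sub_left_eq_self (heatKernel t) volume x, integral_heatKernel ht]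

lemma norm_heatConv_le {t M : ℝ} (ht : 0 < t) {u : E3 → V} (hM : ∀ y, ‖u y‖ ≤ M) (x : E3) :
    ‖heatConv t u x‖ ≤ M := by
  have h : ‖heatConv t u x‖ ≤ ∫ y, heatKernel t (x - y) * M := by
    refine norm_integral_le_of_norm_le (((integrable_heatKernel ht).comp_sub_left x).mul_const M)
      (Eventually.of_forall fun y => ?_)
    rw [norm_smul, Real.norm_of_nonneg (heatKernel_pos ht _).le]
    exact mul_le_mul_of_nonneg_left (hM y) (heatKernel_pos ht _).le
  rwa [integral_mul_const, integral_heatKernel_sub ht, one_mul] at h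

lemma heatConv_sub {t M N : ℝ} (ht : 0 < t) {u v : E3 → V} (hu : AEStronglyMeasurable u)
    (hM : ∀ y, ‖u y‖ ≤ M) (hv : AEStronglyMeasurable v) (hN : ∀ y, ‖v y‖ ≤ N) (x : E3) :
    heatConv t u x - heatConv t v x = heatConv t (fun y => u y - v y) x := by
  unfold heatConv
  rw [← integral_sub (integrable_heatKernel_smul ht hu hM x)
    (integrable_heatKernel_smul ht hv hN x)]
  simp_rw [smul_sub]

lemma heatConv_const [CompleteSpace V] {t : ℝ} (ht : 0 < t) (v : V) (x : E3) :
    heatConv t (fun _ => v) x = v := by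
  unfold heatConv
  rw [integral_smul_const, integral_heatKernel_sub ht, one_smul]

lemma stronglyMeasurable_heatConv (t : ℝ) {u : E3 → V} (hu : StronglyMeasurable u) :
    StronglyMeasurable (heatConv t u) := by
  refine StronglyMeasurable.integral_prod_right (f := fun x y => heatKernel t (x - y) • u y) ?_
  refine StronglyMeasurable.smul ?_ (hu.comp_measurable measurable_snd)
  exact ((continuous_heatKernel t).comp (continuous_fst.sub continuous_snd)).stronglyMeasurable

/-- A field that is at most quadratic around `x` has a heat average of order `t` at `x`. -/
lemma norm_heatConv_le_of_norm_le_sq {t K : ℝ} (ht : 0 < t) {u : E3 → V} {x : E3}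
    (hK : 0 ≤ K) (hu : ∀ y, ‖u y‖ ≤ K * ‖x - y‖ ^ 2) : ‖heatConv t u x‖ ≤ 24 * K * t := by
  have h : ‖heatConv t u x‖ ≤ ∫ y, K * (‖x - y‖ ^ 2 * heatKernel t (x - y)) := by
    refine norm_integral_le_of_norm_le
      (((integrable_sq_norm_mul_heatKernel ht).comp_sub_left x).const_mul K)
      (Eventually.of_forall fun y => ?_)
    rw [norm_smul, Real.norm_of_nonneg (heatKernel_pos ht _).le]
    nlinarith [mul_le_mul_of_nonneg_left (hu y) (heatKernel_pos ht (x - y)).le]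
  rw [integral_const_mul,
    integral_sub_left_eq_self (fun z => ‖z‖ ^ 2 * heatKernel t z) volume x] at h
  nlinarith [mul_le_mul_of_nonneg_left (integral_sq_norm_mul_heatKernel_le ht) hK]

/-- A Lipschitz field is moved by at most `O(√t)` by the heat semigroup. -/
lemma norm_heatConv_sub_self_le [CompleteSpace V] {t M Λ : ℝ} (ht : 0 < t) {u : E3 → V}
    (hu : AEStronglyMeasurable u) (hM : ∀ y, ‖u y‖ ≤ M) (hΛ : 0 ≤ Λ)
    (hLip : ∀ x y, ‖u y - u x‖ ≤ Λ * ‖x - y‖) (x : E3) :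
    ‖heatConv t u x - u x‖ ≤ 25 * Λ * Real.sqrt t := by
  have hs : 0 < Real.sqrt t := Real.sqrt_pos.2 ht
  have hss : Real.sqrt t * Real.sqrt t = t := Real.mul_self_sqrt ht.le
  have hc : heatConv t u x - u x = heatConv t (fun y => u y - u x) x := by
    conv_lhs => rw [← heatConv_const ht (u x) x]
    exact heatConv_sub ht hu hM aestronglyMeasurable_const (fun _ => le_rfl) x
  rw [hc]
  have hi1 := (integrable_sq_norm_mul_heatKernel ht).comp_sub_left x
  have hi2 := (integrable_heatKernel ht).comp_sub_left x
  have h : ‖heatConv t (fun y => u y - u x) x‖ ≤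
      ∫ y, ((Λ / Real.sqrt t) * (‖x - y‖ ^ 2 * heatKernel t (x - y)) +
        (Λ * Real.sqrt t) * heatKernel t (x - y)) := by
    refine norm_integral_le_of_norm_le ((hi1.const_mul _).add (hi2.const_mul _))
      (Eventually.of_forall fun y => ?_)
    have hg := heatKernel_pos ht (x - y)
    rw [norm_smul, Real.norm_of_nonneg hg.le]
    -- Young's inequality at the diffusive scale `√t` reduces the first moment to the second moment
    -- and the mass. They contribute `24` and `1` to the constant `25`.
    have h1 : ‖x - y‖ ≤ ‖x - y‖ ^ 2 / Real.sqrt t + Real.sqrt t := by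
      rw [div_add' _ _ _ hs.ne', le_div_iff₀ hs]
      nlinarith [sq_nonneg (‖x - y‖ - Real.sqrt t), norm_nonneg (x - y)]
    calc _ ≤ heatKernel t (x - y) * (Λ * (‖x - y‖ ^ 2 / Real.sqrt t + Real.sqrt t)) := by
          gcongr
          exact (hLip x y).trans (mul_le_mul_of_nonneg_left h1 hΛ)
      _ = _ := by ring
  rw [integral_add (hi1.const_mul _) (hi2.const_mul _), integral_const_mul, integral_const_mul,
    integral_heatKernel_sub ht,
    integral_sub_left_eq_self (fun z => ‖z‖ ^ 2 * heatKernel t z) volume x] at h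
  have h2 := mul_le_mul_of_nonneg_left (integral_sq_norm_mul_heatKernel_le ht)
    (show 0 ≤ Λ / Real.sqrt t by positivity)
  have h3 : Λ / Real.sqrt t * (24 * t) = 24 * Λ * Real.sqrt t := by
    rw [div_mul_eq_mul_div, div_eq_iff hs.ne']
    linear_combination (-(24 * Λ)) * hss
  linarith

/-- `f` is Lipschitz with constant `L`, and has second-order Taylor remainder at most `K |B - A|²`,
on the ball of radius `R`. -/
structure IsSmoothOnBall (f : V → V) (R L K : ℝ) : Prop where
  nonneg_lip : 0 ≤ L
  nonneg_taylor : 0 ≤ K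
  lipschitz : ∀ A B, ‖A‖ ≤ R → ‖B‖ ≤ R → ‖f A - f B‖ ≤ L * ‖A - B‖
  taylor : ∀ A, ‖A‖ ≤ R → ∃ l : V →L[ℝ] V, ∀ B, ‖B‖ ≤ R → ‖f B - f A - l (B - A)‖ ≤ K * ‖B - A‖ ^ 2

lemma exists_isSmoothOnBall [FiniteDimensional ℝ V] {f : V → V} (hf : ContDiff ℝ 2 f) (R : ℝ) :
    ∃ L K, IsSmoothOnBall f R L K := by
  have hc : IsCompact (Metric.closedBall (0 : V) R) :=
    have := FiniteDimensional.proper ℝ V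
    isCompact_closedBall 0 R
  have hf' : ContDiff ℝ 1 (fderiv ℝ f) := hf.fderiv_right (by norm_num)
  obtain ⟨L, hL⟩ := (hf.of_le one_le_two).locallyLipschitz.locallyLipschitzOn
    |>.exists_lipschitzOnWith_of_compact hc
  obtain ⟨K, hK⟩ := hf'.locallyLipschitz.locallyLipschitzOn
    |>.exists_lipschitzOnWith_of_compact hc
  refine ⟨L, K, L.2, K.2, fun A B hA hB => ?_, fun A hA => ⟨fderiv ℝ f A, fun B hB => ?_⟩⟩
  · exact hL.norm_sub_le (mem_closedBall_zero_iff.2 hA) (mem_closedBall_zero_iff.2 hB)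
  -- Mean value inequality on a convex set containing `A` and `B`. Intersecting with the ball of
  -- radius `‖B - A‖` about `A` keeps the derivative within `K * ‖B - A‖` of its value at `A`.
  · have h := Convex.norm_image_sub_le_of_norm_hasFDerivWithin_le' (f := f) (f' := fderiv ℝ f)
      (φ := fderiv ℝ f A) (C := K * ‖B - A‖)
      (s := Metric.closedBall 0 R ∩ Metric.closedBall A ‖B - A‖) (x := A) (y := B)
      (fun z _ => ((hf.differentiable (by norm_num)) z).hasFDerivAt.hasFDerivWithinAt)
      (fun z hz => (hK.norm_sub_le hz.1 (mem_closedBall_zero_iff.2 hA)).trans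
        (mul_le_mul_of_nonneg_left (mem_closedBall_iff_norm.1 hz.2) K.2))
      ((convex_closedBall _ _).inter (convex_closedBall _ _))
      ⟨mem_closedBall_zero_iff.2 hA, Metric.mem_closedBall_self (norm_nonneg _)⟩
      ⟨mem_closedBall_zero_iff.2 hB, mem_closedBall_iff_norm.2 le_rfl⟩
    rwa [mul_assoc, ← sq] at h

/-- The commutator of the heat semigroup with a nonlinearity is of order `t` on Lipschitz
fields. -/
lemma norm_heatConv_comp_sub_le [CompleteSpace V] {t M Λ L K N : ℝ} (ht : 0 < t) {f : V → V}
    (hf : IsSmoothOnBall f M L K) (hfc : Continuous f) {u : E3 → V} (hu : Continuous u)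
    (hM : ∀ y, ‖u y‖ ≤ M) (hN : ∀ y, ‖f (u y)‖ ≤ N) (hΛ : 0 ≤ Λ)
    (hLip : ∀ x y, ‖u y - u x‖ ≤ Λ * ‖x - y‖) (x : E3) :
    ‖heatConv t (fun y => f (u y)) x - f (heatConv t u x)‖ ≤ 649 * K * Λ ^ 2 * t := by
  have hK := hf.nonneg_taylor
  -- Both terms are expanded about `u x`. The linear part `l` commutes with the heat average and
  -- cancels, which leaves two remainders: the averaged one (constant `24`) and the one at the
  -- averaged value (constant `25² = 625`), in total `649`.
  obtain ⟨l, hl⟩ := hf.taylor (u x) (hM x)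
  have hd : ∀ y, ‖u y - u x‖ ≤ M + M := fun y =>
    (norm_sub_le _ _).trans (add_le_add (hM y) (hM x))
  have hul : Continuous fun y => l (u y - u x) := l.continuous.comp (hu.sub continuous_const)
  have hud : Continuous fun y => u y - u x := hu.sub continuous_const
  have hld : ∀ y, ‖l (u y - u x)‖ ≤ ‖l‖ * (M + M) := fun y => l.le_opNorm_of_le (hd y)
  have e1 : heatConv t u x - u x = heatConv t (fun y => u y - u x) x := by
    conv_lhs => rw [← heatConv_const ht (u x) x]
    exact heatConv_sub ht hu.aestronglyMeasurable hM aestronglyMeasurable_const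
      (fun _ => le_rfl) x
  have e2 : l (heatConv t u x - u x) = heatConv t (fun y => l (u y - u x)) x := by
    rw [e1]
    unfold heatConv
    rw [← l.integral_comp_comm (integrable_heatKernel_smul ht
      hud.aestronglyMeasurable hd x)]
    simp_rw [map_smul]
  have hfu : Continuous fun y => f (u y) := hfc.comp hu
  have hfud : Continuous fun y => f (u y) - f (u x) := hfu.sub continuous_const
  have hfd : ∀ y, ‖f (u y) - f (u x)‖ ≤ N + N := fun y =>
    (norm_sub_le _ _).trans (add_le_add (hN y) (hN x))
  have e3 : heatConv t (fun y => f (u y)) x - f (u x) - l (heatConv t u x - u x) =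
      heatConv t (fun y => f (u y) - f (u x) - l (u y - u x)) x := by
    rw [e2]
    conv_lhs => rw [← heatConv_const ht (f (u x)) x]
    rw [heatConv_sub ht hfu.aestronglyMeasurable hN aestronglyMeasurable_const
      (fun _ => le_rfl) x, heatConv_sub ht hfud.aestronglyMeasurable hfd
      hul.aestronglyMeasurable hld x]
  have b1 : ‖heatConv t (fun y => f (u y)) x - f (u x) - l (heatConv t u x - u x)‖ ≤
      24 * (K * Λ ^ 2) * t := by
    rw [e3]
    refine norm_heatConv_le_of_norm_le_sq ht (by positivity) fun y => (hl _ (hM y)).trans ?_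
    rw [mul_assoc, ← mul_pow]
    gcongr
    exact hLip x y
  have b2 : ‖f (heatConv t u x) - f (u x) - l (heatConv t u x - u x)‖ ≤ 625 * K * Λ ^ 2 * t := by
    refine (hl _ (norm_heatConv_le ht hM x)).trans ?_
    have h := norm_heatConv_sub_self_le ht hu.aestronglyMeasurable hM hΛ hLip x
    calc _ ≤ K * (25 * Λ * Real.sqrt t) ^ 2 := by gcongr
      _ = _ := by rw [mul_pow, Real.sq_sqrt ht.le]; ring
  have e4 : heatConv t (fun y => f (u y)) x - f (heatConv t u x) =
      (heatConv t (fun y => f (u y)) x - f (u x) - l (heatConv t u x - u x)) -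
        (f (heatConv t u x) - f (u x) - l (heatConv t u x - u x)) := by abel
  rw [e4]
  refine (norm_sub_le _ _).trans ((add_le_add b1 b2).trans (le_of_eq ?_))
  ring

/-! ### The local error -/

variable {c T M Λ L K : ℝ} {f : V → V} {q : ℝ → E3 → V}

lemma IsBoundedWeakSolution.continuousOn_heatConv {F : ℝ → E3 → V}
    (h : IsBoundedWeakSolution c T M q F) (hc : 0 < c) {ε t : ℝ} (hε : 0 < ε) (x : E3) :
    ContinuousOn (fun s => heatConv (ε + c * t - c * s) (q s) x) (Iic t) ∧
      ContinuousOn (fun s => heatConv (ε + c * t - c * s) (F s) x) (Iic t) := by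
  have hpos : ∀ s ∈ Iic t, 0 < ε + c * t - c * s := fun s hs => by
    have : c * s ≤ c * t := mul_le_mul_of_nonneg_left hs hc.le
    linarith
  have hg : Continuous fun s => (s, ε + c * t - c * s) := by fun_prop
  exact ⟨fun s hs => ((continuousAt_heatConv h.cont h.bound x (s, ε + c * t - c * s)
      (hpos s hs)).comp (f := fun s => (s, ε + c * t - c * s)) (x := s)
      hg.continuousAt).continuousWithinAt,
    fun s hs => ((continuousAt_heatConv h.cont_source h.bound_source x (s, ε + c * t - c * s)
      (hpos s hs)).comp (f := fun s => (s, ε + c * t - c * s)) (x := s)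
      hg.continuousAt).continuousWithinAt⟩

/-- Duhamel's formula, regularized. -/
lemma IsBoundedWeakSolution.heatConv_sub_eq_integral [CompleteSpace V] {F : ℝ → E3 → V}
    (h : IsBoundedWeakSolution c T M q F) (hc : 0 < c) {ε r s t : ℝ} (hε : 0 < ε) (hr : 0 ≤ r)
    (hrs : r ≤ s) (hst : s ≤ t) (ht : t ≤ T) (x : E3) :
    IntervalIntegrable (fun s => heatConv (ε + c * t - c * s) (F s) x) volume r s ∧
    ∫ s in r..s, heatConv (ε + c * t - c * s) (F s) x =
      heatConv (ε + c * t - c * s) (q s) x - heatConv (ε + c * t - c * r) (q r) x := by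
  obtain ⟨h1, h2⟩ := h.continuousOn_heatConv hc (t := t) hε x
  have hsub : Icc r s ⊆ Iic t := fun y hy => hy.2.trans hst
  have hint : IntervalIntegrable (fun s => heatConv (ε + c * t - c * s) (F s) x) volume r s :=
    (h2.mono hsub).intervalIntegrable_of_Icc hrs
  refine ⟨hint, intervalIntegral.integral_eq_sub_of_hasDerivAt_of_le hrs (h1.mono hsub)
    (fun y hy => h.hasDerivAt_heatConv ?_ ⟨hr.trans_lt hy.1, hy.2.trans_le (hst.trans ht)⟩ x) hint⟩
  have : c * y ≤ c * t := mul_le_mul_of_nonneg_left (hy.2.le.trans hst) hc.le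
  linarith

/-- The scheme has a local error of second order. -/
lemma IsBoundedWeakSolution.norm_local_error_le [CompleteSpace V]
    (h : IsBoundedWeakSolution c T M q fun s y => f (q s y)) (hc : 0 < c) (hM : 0 ≤ M)
    (hf : IsSmoothOnBall f M L K) (hfc : Continuous f) (hΛ : 0 ≤ Λ)
    (hLip : ∀ s x y, ‖q s y - q s x‖ ≤ Λ * ‖x - y‖)
    {r t : ℝ} (hr : 0 ≤ r) (hrt : r < t) (ht : t ≤ T) (x : E3) :
    ‖q t x - (heatConv (c * (t - r)) (q r) x + (t - r) • f (heatConv (c * (t - r)) (q r) x))‖ ≤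
      (649 * K * Λ ^ 2 * c + L * M) * (t - r) ^ 2 := by
  have hq : ∀ s, Continuous (q s) := fun s => h.cont.comp (Continuous.prodMk_right s)
  have hτ : 0 < t - r := sub_pos.2 hrt
  have hcτ : 0 < c * (t - r) := mul_pos hc hτ
  have hL := hf.nonneg_lip
  have hK := hf.nonneg_taylor
  -- The extra heat time `ε` keeps the kernel away from its singularity at time `0`; it is removed
  -- by a limit at the end.
  have key : ∀ ε > 0, ‖heatConv ε (q t) x - (heatConv (ε + c * (t - r)) (q r) x +
      (t - r) • f (heatConv (ε + c * (t - r)) (q r) x))‖ ≤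
      (649 * K * Λ ^ 2 * (ε + c * (t - r)) + L * (M * (t - r))) * (t - r) := fun ε hε => by
    set H : ℝ → V := fun s => heatConv (ε + c * t - c * s) (q s) x with hH
    set D : ℝ → V := fun s => heatConv (ε + c * t - c * s) (fun y => f (q s y)) x with hD
    have hpos : ∀ s ≤ t, 0 < ε + c * t - c * s := fun s hs => by
      have : c * s ≤ c * t := mul_le_mul_of_nonneg_left hs hc.le
      linarith
    have hHt : heatConv ε (q t) x = H t := by simp [hH]
    have hHr : heatConv (ε + c * (t - r)) (q r) x = H r := by
      simp only [hH]
      congr 1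
      ring
    rw [hHt, hHr]
    have hHs : ∀ s ∈ Icc r t, ‖H s - H r‖ ≤ M * (t - r) := fun s hs => by
      rw [← (h.heatConv_sub_eq_integral hc hε hr hs.1 hs.2 ht x).2]
      refine (intervalIntegral.norm_integral_le_of_norm_le_const (C := M) fun y hy => ?_).trans ?_
      · rw [uIoc_of_le hs.1] at hy
        exact norm_heatConv_le (hpos y (hy.2.trans hs.2)) (h.bound_source y) x
      · rw [abs_of_nonneg (sub_nonneg.2 hs.1)]
        exact mul_le_mul_of_nonneg_left (by linarith [hs.2]) hM
    obtain ⟨hint, hsub⟩ := h.heatConv_sub_eq_integral hc hε hr hrt.le le_rfl ht x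
    -- By Duhamel's formula the error is that of a left-endpoint rule with frozen value `f (H r)`.
    -- The integrand splits into the commutator `D s - f (H s)` and the variation `f (H s) - f (H
    -- r)`.
    have e : H t - (H r + (t - r) • f (H r)) = ∫ s in r..t, (D s - f (H r)) := by
      rw [intervalIntegral.integral_sub hint intervalIntegrable_const,
        intervalIntegral.integral_const, hsub]
      abel
    rw [e]
    refine (intervalIntegral.norm_integral_le_of_norm_le_const
      (C := 649 * K * Λ ^ 2 * (ε + c * (t - r)) + L * (M * (t - r))) fun s hs => ?_).trans
      (le_of_eq (by rw [abs_of_pos hτ]))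
    rw [uIoc_of_le hrt.le] at hs
    have b1 : ‖D s - f (H s)‖ ≤ 649 * K * Λ ^ 2 * (ε + c * (t - r)) := by
      refine (norm_heatConv_comp_sub_le (hpos s hs.2) hf hfc (hq s) (h.bound s)
        (h.bound_source s) hΛ (hLip s) x).trans ?_
      have : c * r ≤ c * s := mul_le_mul_of_nonneg_left hs.1.le hc.le
      refine mul_le_mul_of_nonneg_left (by linarith) (by positivity)
    have b2 : ‖f (H s) - f (H r)‖ ≤ L * (M * (t - r)) :=
      (hf.lipschitz _ _ (norm_heatConv_le (hpos s hs.2) (h.bound s) x)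
        (norm_heatConv_le (hpos r hrt.le) (h.bound r) x)).trans
        (mul_le_mul_of_nonneg_left (hHs s ⟨hs.1.le, hs.2⟩) hL)
    exact (norm_sub_le_norm_sub_add_norm_sub _ _ _).trans (add_le_add b1 b2)
  have hgc : ContinuousAt (fun ε => heatConv (ε + c * (t - r)) (q r) x) 0 := by
    have h1 : ContinuousAt (fun σ => heatConv σ (q r) x) (0 + c * (t - r)) :=
      (hasDerivAt_heatConv_time (hq r) (h.bound r) (by simpa using hcτ) x).continuousAt
    exact h1.comp (f := fun ε : ℝ => ε + c * (t - r)) (x := 0) (by fun_prop)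
  have hP : Tendsto (fun ε => heatConv (ε + c * (t - r)) (q r) x) (𝓝[>] 0)
      (𝓝 (heatConv (c * (t - r)) (q r) x)) := by
    have := hgc.tendsto.mono_left (nhdsWithin_le_nhds (s := Ioi 0))
    rwa [zero_add] at this
  -- Since `q t` is Lipschitz, `heatConv ε` moves it by `O(√ε)`.
  have hQ : Tendsto (fun ε => heatConv ε (q t) x) (𝓝[>] 0) (𝓝 (q t x)) := by
    rw [tendsto_iff_norm_sub_tendsto_zero]
    have h0 : Tendsto (fun ε => 25 * Λ * Real.sqrt ε) (𝓝[>] 0) (𝓝 0) := by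
      have : Continuous fun ε => 25 * Λ * Real.sqrt ε := by fun_prop
      simpa using (this.tendsto 0).mono_left (nhdsWithin_le_nhds (s := Ioi 0))
    refine squeeze_zero' (Eventually.of_forall fun _ => norm_nonneg _) ?_ h0
    filter_upwards [self_mem_nhdsWithin] with ε hε
    exact norm_heatConv_sub_self_le hε (hq t).aestronglyMeasurable (h.bound t) hΛ (hLip t) x
  have hlim := (hQ.sub (hP.add (((hfc.tendsto _).comp hP).const_smul (t - r)))).norm
  have hr : Tendsto (fun ε => (649 * K * Λ ^ 2 * (ε + c * (t - r)) + L * (M * (t - r))) * (t - r))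
      (𝓝[>] 0) (𝓝 ((649 * K * Λ ^ 2 * (0 + c * (t - r)) + L * (M * (t - r))) * (t - r))) := by
    have : Continuous fun ε =>
        (649 * K * Λ ^ 2 * (ε + c * (t - r)) + L * (M * (t - r))) * (t - r) := by fun_prop
    exact (this.tendsto 0).mono_left nhdsWithin_le_nhds
  refine (le_of_tendsto_of_tendsto hlim hr ?_).trans (le_of_eq (by ring))
  filter_upwards [self_mem_nhdsWithin] with ε hε using key ε hε

end

/-! ### Global error of the vector-valued scheme -/

section

variable {V : Type*} [NormedAddCommGroup V] [NormedSpace ℝ V]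

/-- The scheme `u_{m+1} = e^{κΔ} u_m + τ f(e^{κΔ} u_m)`. -/
def scheme (κ τ : ℝ) (f : V → V) (u : E3 → V) : ℕ → E3 → V
  | 0 => u
  | m + 1 => fun x => heatConv κ (scheme κ τ f u m) x + τ • f (heatConv κ (scheme κ τ f u m) x)

/-- Purely qualitative: the bound may grow with `m`. It makes the convolutions of the iterates
integrable, and it treats the step sizes outside the Gronwall argument. -/
lemma scheme_measurable_bounded [FiniteDimensional ℝ V] {κ τ M : ℝ} (hκ : 0 < κ) {f : V → V}
    (hf : Continuous f) {u : E3 → V} (hu : Continuous u) (hM : ∀ x, ‖u x‖ ≤ M) (m : ℕ) :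
    StronglyMeasurable (scheme κ τ f u m) ∧ ∃ B, ∀ x, ‖scheme κ τ f u m x‖ ≤ B := by
  induction m with
  | zero => exact ⟨hu.stronglyMeasurable, M, hM⟩
  | succ m ih =>
    obtain ⟨hm, B, hB⟩ := ih
    have hh := stronglyMeasurable_heatConv κ hm
    have := FiniteDimensional.proper ℝ V
    obtain ⟨N, hN⟩ := (isCompact_closedBall (0 : V) B).exists_bound_of_continuousOn
      (f := fun A => A + τ • f A) (by fun_prop)
    exact ⟨hh.add ((hf.comp_stronglyMeasurable hh).const_smul τ), N, fun x =>
      hN _ (mem_closedBall_zero_iff.2 (norm_heatConv_le hκ hB x))⟩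

lemma IsSmoothOnBall.mono {f : V → V} {R R' L K : ℝ} (h : IsSmoothOnBall f R L K) (hR : R' ≤ R) :
    IsSmoothOnBall f R' L K where
  nonneg_lip := h.nonneg_lip
  nonneg_taylor := h.nonneg_taylor
  lipschitz A B hA hB := h.lipschitz A B (hA.trans hR) (hB.trans hR)
  taylor A hA := (h.taylor A (hA.trans hR)).imp fun _ hl B hB => hl B (hB.trans hR)

variable [FiniteDimensional ℝ V] {c T M Λ L K : ℝ} {f : V → V} {q : ℝ → E3 → V}

/-- Convergence of first order for small step sizes, for which the scheme stays in the unit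
neighbourhood of the solution. -/
lemma norm_scheme_sub_le
    (h : IsBoundedWeakSolution c T M q fun s y => f (q s y)) (hc : 0 < c) (hT : 0 < T) (hM : 0 ≤ M)
    (hf : IsSmoothOnBall f (M + 1) L K) (hfc : Continuous f) (hΛ : 0 ≤ Λ)
    (hLip : ∀ s x y, ‖q s y - q s x‖ ≤ Λ * ‖x - y‖) {A : ℝ}
    (hA : A = 649 * K * Λ ^ 2 * c + L * M) {n : ℕ} {τ : ℝ} (hτ : 0 < τ) (hn : n * τ = T)
    (hsmall : A * T * Real.exp (L * T) * τ ≤ 1) {m : ℕ} (hm : m ≤ n) (x : E3) :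
    ‖scheme (c * τ) τ f (q 0) m x - q (m * τ) x‖ ≤ A * T * Real.exp (L * T) * τ := by
  have hL := hf.nonneg_lip
  have hK := hf.nonneg_taylor
  have hA0 : 0 ≤ A := by rw [hA]; positivity
  have hcτ : 0 < c * τ := mul_pos hc hτ
  have hq : ∀ s, Continuous (q s) := fun s => h.cont.comp (Continuous.prodMk_right s)
  have hmT : ∀ m : ℕ, m ≤ n → m * τ ≤ T := fun m hm => by
    rw [← hn]
    gcongr
  have hle : ∀ m : ℕ, m ≤ n →
      A * τ ^ 2 * m * Real.exp (L * (m * τ)) ≤ A * T * Real.exp (L * T) * τ := fun m hm => by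
    have h1 := hmT m hm
    calc A * τ ^ 2 * m * Real.exp (L * (m * τ)) = A * τ * (m * τ) * Real.exp (L * (m * τ)) := by
          ring
      _ ≤ A * τ * T * Real.exp (L * T) := by gcongr
      _ = _ := by ring
  -- The induction runs on the finer bound `A τ² m exp(L m τ)`, whose growth from `m` to `m + 1`
  -- accommodates one more local error.
  refine le_trans ?_ (hle m hm)
  induction m generalizing x with
  | zero => simp [scheme]
  | succ m ih =>
    have hm' : m ≤ n := (Nat.le_succ m).trans hm
    set y := scheme (c * τ) τ f (q 0) m with hy
    set e := A * τ ^ 2 * m * Real.exp (L * (m * τ)) with he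
    have he1 : e ≤ 1 := (hle m hm').trans hsmall
    have ih' : ∀ x, ‖y x - q (m * τ) x‖ ≤ e := fun x => ih hm' x
    obtain ⟨hym, B, hB⟩ := scheme_measurable_bounded (τ := τ) hcτ hfc (hq 0) (h.bound 0) m
    -- The error so far is at most `1`, so the iterate stays in the ball on which `L` is a Lipschitz
    -- constant of `f`.
    have hyM : ∀ x, ‖y x‖ ≤ M + 1 := fun x => by
      have h1 := norm_le_norm_add_norm_sub (q (m * τ) x) (y x)
      rw [norm_sub_rev] at h1
      linarith [h.bound (m * τ) x, ih' x]
    set P := heatConv (c * τ) y x with hP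
    set R := heatConv (c * τ) (q (m * τ)) x with hR
    have hPR : ‖P - R‖ ≤ e := by
      rw [hP, hR, heatConv_sub hcτ hym.aestronglyMeasurable hB
        (hq _).aestronglyMeasurable (h.bound _) x]
      exact norm_heatConv_le hcτ ih' x
    have hPn : ‖P‖ ≤ M + 1 := norm_heatConv_le hcτ hyM x
    have hRn : ‖R‖ ≤ M + 1 := (norm_heatConv_le hcτ (h.bound _) x).trans (by linarith)
    have hloc : ‖q ((m + 1 : ℕ) * τ) x - (R + τ • f R)‖ ≤ A * τ ^ 2 := by
      have e1 : ((m + 1 : ℕ) : ℝ) * τ - m * τ = τ := by push_cast; ring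
      have h1 := h.norm_local_error_le hc hM (hf.mono (by linarith)) hfc hΛ hLip
        (r := m * τ) (t := (m + 1 : ℕ) * τ) (by positivity) (by linarith) (hmT _ hm) x
      rw [e1, ← hA] at h1
      exact h1
    have hfPR : ‖τ • (f P - f R)‖ ≤ τ * (L * e) := by
      rw [norm_smul, Real.norm_of_nonneg hτ.le]
      exact mul_le_mul_of_nonneg_left ((hf.lipschitz _ _ hPn hRn).trans
        (mul_le_mul_of_nonneg_left hPR hL)) hτ.le
    -- Propagated error of one scheme step, applied to the iterate and to the exact solution, minus
    -- the local error.
    have e2 : scheme (c * τ) τ f (q 0) (m + 1) x - q ((m + 1 : ℕ) * τ) x =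
        (P - R) + τ • (f P - f R) - (q ((m + 1 : ℕ) * τ) x - (R + τ • f R)) := by
      have : scheme (c * τ) τ f (q 0) (m + 1) x = P + τ • f P := rfl
      rw [this, smul_sub]
      abel
    rw [e2]
    refine (norm_sub_le _ _).trans ((add_le_add (norm_add_le _ _) hloc).trans ?_)
    have hexp : (1 + L * τ) * Real.exp (L * (m * τ)) ≤ Real.exp (L * ((m + 1 : ℕ) * τ)) := by
      have e3 : L * ((m + 1 : ℕ) * τ) = L * τ + L * (m * τ) := by push_cast; ring
      rw [e3, Real.exp_add]
      have := Real.add_one_le_exp (L * τ)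
      gcongr
      linarith
    have hexp1 : 1 ≤ Real.exp (L * ((m + 1 : ℕ) * τ)) := Real.one_le_exp (by positivity)
    calc ‖P - R‖ + ‖τ • (f P - f R)‖ + A * τ ^ 2 ≤ e + τ * (L * e) + A * τ ^ 2 := by gcongr
      _ = A * τ ^ 2 * m * ((1 + L * τ) * Real.exp (L * (m * τ))) + A * τ ^ 2 * 1 := by
          rw [he]; ring
      _ ≤ A * τ ^ 2 * m * Real.exp (L * ((m + 1 : ℕ) * τ)) +
          A * τ ^ 2 * Real.exp (L * ((m + 1 : ℕ) * τ)) := by gcongr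
      _ = _ := by push_cast; ring

/-- Convergence of first order of the scheme: the finitely many step sizes that are too large for
`norm_scheme_sub_le` only enlarge the constant. -/
theorem exists_norm_scheme_sub_le
    (h : IsBoundedWeakSolution c T M q fun s y => f (q s y)) (hc : 0 < c) (hT : 0 < T) (hM : 0 ≤ M)
    (hf : ContDiff ℝ 2 f) (hΛ : 0 ≤ Λ)
    (hLip : ∀ s x y, ‖q s y - q s x‖ ≤ Λ * ‖x - y‖) :
    ∃ K > 0, ∀ n : ℕ, 1 ≤ n → ∀ τ : ℝ, τ = T / n → ∀ m ≤ n, ∀ x,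
      ‖scheme (c * τ) τ f (q 0) m x - q (m * τ) x‖ ≤ K * τ := by
  obtain ⟨L, K, hfs⟩ := exists_isSmoothOnBall hf (M + 1)
  have hL := hfs.nonneg_lip
  have hK := hfs.nonneg_taylor
  have hq : ∀ s, Continuous (q s) := fun s => h.cont.comp (Continuous.prodMk_right s)
  set κ := (649 * K * Λ ^ 2 * c + L * M) * T * Real.exp (L * T) with hκ
  have hκ0 : 0 ≤ κ := by positivity
  have hB : ∀ n : ℕ, ∃ B, 1 ≤ n → ∀ m ≤ n, ∀ x,
      ‖scheme (c * (T / n)) (T / n) f (q 0) m x - q (m * (T / n)) x‖ ≤ B := fun n => by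
    by_cases hn : 1 ≤ n
    · have hn' : (0 : ℝ) < n := by exact_mod_cast hn
      choose hm B hB using fun m => scheme_measurable_bounded (κ := c * (T / n)) (τ := T / n)
        (by positivity) hf.continuous (hq 0) (h.bound 0) m
      refine ⟨(∑ m ∈ Finset.range (n + 1), B m) + M, fun _ m hmn x => ?_⟩
      refine (norm_sub_le _ _).trans (add_le_add ((hB m x).trans ?_) (h.bound _ x))
      exact Finset.single_le_sum (f := B) (fun i _ => (norm_nonneg _).trans (hB i 0))
        (Finset.mem_range.2 (Nat.lt_succ_of_le hmn))
    · exact ⟨0, fun h => absurd h hn⟩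
  choose B hB using hB
  obtain ⟨N, hN⟩ := exists_nat_gt (κ * T)
  have hS : 0 ≤ ∑ n ∈ Finset.range N, |B n| * n / T :=
    Finset.sum_nonneg fun n _ => by positivity
  -- For `n ≥ N > κ T` the smallness condition `κ τ ≤ 1` holds. For each smaller `n` the crude bound
  -- `B n` equals `(B n * n / T) * τ`; the final `1` ensures positivity.
  refine ⟨κ + ∑ n ∈ Finset.range N, |B n| * n / T + 1, by positivity, ?_⟩
  rintro n hn τ rfl m hm x
  have hn' : (0 : ℝ) < n := by exact_mod_cast hn
  have hτ : 0 < T / n := by positivity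
  by_cases hnN : N ≤ n
  · have hsmall : κ * (T / n) ≤ 1 := by
      rw [← mul_div_assoc, div_le_one hn']
      exact hN.le.trans (by exact_mod_cast hnN)
    refine (norm_scheme_sub_le h hc hT hM hfs hf.continuous hΛ hLip rfl hτ
      (by field_simp) hsmall hm x).trans ?_
    exact mul_le_mul_of_nonneg_right (by linarith) hτ.le
  · refine (hB n hn m hm x).trans ?_
    have h1 : |B n| * n / T ≤ ∑ n ∈ Finset.range N, |B n| * n / T :=
      Finset.single_le_sum (f := fun n : ℕ => |B n| * n / T) (fun n _ => by positivity)
        (Finset.mem_range.2 (not_le.1 hnN))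
    calc B n ≤ |B n| := le_abs_self _
      _ = |B n| * n / T * (T / n) := by field_simp
      _ ≤ _ := mul_le_mul_of_nonneg_right (by linarith) hτ.le

end

/-! ### Fields of class `W^{1,∞}` -/

lemma abs_apply_le_of_abs_apply_single_le {l : E3 →L[ℝ] ℝ} {N : ℝ}
    (h : ∀ k, |l (EuclideanSpace.single k 1)| ≤ N) (v : E3) : |l v| ≤ 3 * N * ‖v‖ := by
  have hv : v = ∑ k, v k • EuclideanSpace.single k (1 : ℝ) := by
    have := (EuclideanSpace.basisFun (Fin 3) ℝ).sum_repr v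
    simpa using this.symm
  conv_lhs => rw [hv, map_sum]
  refine (Finset.abs_sum_le_sum_abs _ _).trans ?_
  refine (Finset.sum_le_card_nsmul _ _ (N * ‖v‖) fun k _ => ?_).trans (le_of_eq ?_)
  · rw [map_smul, smul_eq_mul, abs_mul, mul_comm]
    exact mul_le_mul (h k) (PiLp.norm_apply_le v k) (abs_nonneg _) ((abs_nonneg _).trans (h k))
  · simp
    ring

/-- A continuous function with bounded weak gradient is Lipschitz. -/
lemma abs_sub_le_of_weak_gradient {w : E3 → ℝ} {G : Fin 3 → E3 → ℝ} {N : ℝ} (hw : Continuous w)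
    (hG : ∀ k, ∀ φ : E3 → ℝ, IsTest φ →
      ∫ x, w x * fderiv ℝ φ x (EuclideanSpace.single k 1) = -∫ x, G k x * φ x)
    (hN : ∀ k, ∀ᵐ x, |G k x| ≤ N) (x y : E3) : |w y - w x| ≤ 3 * N * ‖x - y‖ := by
  let ρ : ℕ → ContDiffBump (0 : E3) := fun n =>
    ⟨1 / ((n : ℝ) + 1) / 2, 1 / ((n : ℝ) + 1), by positivity, by
      have : 0 < 1 / ((n : ℝ) + 1) := by positivity
      linarith⟩
  let r : ℕ → E3 → ℝ := fun n => (ρ n).normed volume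
  let W : ℕ → E3 → ℝ := fun n => convolution w (r n) (ContinuousLinearMap.mul ℝ ℝ) volume
  have hr : ∀ n, ContDiff ℝ ∞ (r n) := fun n => (ρ n).contDiff_normed
  have hrc : ∀ n, HasCompactSupport (r n) := fun n => (ρ n).hasCompactSupport_normed
  have hlim : ∀ z, Tendsto (fun n => W n z) atTop (𝓝 (w z)) := fun z => by
    have h := ContDiffBump.convolution_tendsto_right_of_continuous (μ := volume) (φ := ρ)
      tendsto_one_div_add_atTop_nhds_zero_nat hw z
    refine h.congr fun n => ?_
    rw [convolution_lsmul_swap]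
    refine integral_congr_ae (Eventually.of_forall fun t => ?_)
    simp [r, mul_comm]
  have hd : ∀ n z, HasFDerivAt (W n)
      ((convolution w (fderiv ℝ (r n)) ((ContinuousLinearMap.mul ℝ ℝ).precompR E3) volume) z) z :=
    fun n z => (hrc n).hasFDerivAt_convolution_right _ hw.locallyIntegrable
      ((hr n).of_le (by simp)) z
  have hb : ∀ n z, ‖fderiv ℝ (W n) z‖ ≤ 3 * N := fun n z => by
    have hN0 : 0 ≤ N := by
      obtain ⟨z, hz⟩ := (hN 0).exists
      exact (abs_nonneg _).trans hz
    refine ContinuousLinearMap.opNorm_le_bound _ (by positivity) fun v => ?_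
    refine abs_apply_le_of_abs_apply_single_le (fun k => ?_) v
    rw [(hd n z).fderiv, convolution_precompR_apply _ hw.locallyIntegrable ((hrc n).fderiv (𝕜 := ℝ))
      ((hr n).continuous_fderiv (by simp))]
    have hφ : IsTest fun t => r n (z - t) :=
      ⟨(hr n).comp (contDiff_const.sub contDiff_id), (hrc n).comp_homeomorph (Homeomorph.subLeft z)⟩
    have hφd : ∀ t, fderiv ℝ (fun t => r n (z - t)) t (EuclideanSpace.single k 1) =
        -fderiv ℝ (r n) (z - t) (EuclideanSpace.single k 1) := fun t => by
      have h1 : HasFDerivAt (fun t => r n (z - t)) _ t :=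
        (((hr n).differentiable (by simp)) (z - t)).hasFDerivAt.comp t
          ((hasFDerivAt_id t).const_sub z)
      rw [h1.fderiv]
      simp
    have e := hG k _ hφ
    simp_rw [hφd, mul_neg] at e
    rw [integral_neg, neg_inj] at e
    -- The derivative of the mollification falls on the mollifier, whose reflected translate is a
    -- test function; the weak gradient then takes it over. As the mollifier is nonnegative of mass
    -- one, the bound `N` survives.
    have e' : convolution w (fun a => fderiv ℝ (r n) a (EuclideanSpace.single k 1))
        (ContinuousLinearMap.mul ℝ ℝ) volume z = ∫ t, G k t * r n (z - t) := e
    rw [e', ← Real.norm_eq_abs]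
    have hle : ‖∫ t, G k t * r n (z - t)‖ ≤ ∫ t, N * r n (z - t) := by
      refine norm_integral_le_of_norm_le (hφ.integrable.const_mul N) ?_
      filter_upwards [hN k] with t ht
      rw [norm_mul, Real.norm_eq_abs, Real.norm_of_nonneg ((ρ n).nonneg_normed _)]
      exact mul_le_mul_of_nonneg_right ht ((ρ n).nonneg_normed _)
    rwa [integral_const_mul, integral_sub_left_eq_self (r n) volume z,
      (ρ n).integral_normed, mul_one] at hle
  refine le_of_tendsto ((hlim y).sub (hlim x)).abs (Eventually.of_forall fun n => ?_)
  have := Convex.norm_image_sub_le_of_norm_fderiv_le (𝕜 := ℝ) (s := univ) (f := W n)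
    (fun z _ => (hd n z).differentiableAt) (fun z _ => hb n z) convex_univ (mem_univ x) (mem_univ y)
  rwa [norm_sub_rev y x] at this

lemma contract_self_nonneg (A : Mat3) : 0 ≤ contract A A :=
  Finset.sum_nonneg fun _ _ => Finset.sum_nonneg fun _ _ => mul_self_nonneg _

lemma sq_apply_le_contract (A : Mat3) (i j : Fin 3) : A i j ^ 2 ≤ contract A A := by
  rw [sq]
  refine le_trans ?_ (Finset.single_le_sum (f := fun i => ∑ j, A i j * A i j)
    (fun i _ => Finset.sum_nonneg fun _ _ => mul_self_nonneg _) (Finset.mem_univ i))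
  exact Finset.single_le_sum (f := fun j => A i j * A i j) (fun _ _ => mul_self_nonneg _)
    (Finset.mem_univ j)

lemma abs_apply_le_frob (A : Mat3) (i j : Fin 3) : |A i j| ≤ frob A :=
  Real.abs_le_sqrt (sq_apply_le_contract A i j)

lemma abs_apply_le_gradFrob (G : Fin 3 → Mat3) (k i j : Fin 3) : |G k i j| ≤ gradFrob G :=
  Real.abs_le_sqrt ((sq_apply_le_contract (G k) i j).trans
    (Finset.single_le_sum (f := fun k => contract (G k) (G k)) (fun _ _ => contract_self_nonneg _)
      (Finset.mem_univ k)))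

lemma frob_le_of_abs_apply_le {A : Mat3} {N : ℝ} (h : ∀ i j, |A i j| ≤ N) : frob A ≤ 3 * N := by
  have hN : 0 ≤ N := (abs_nonneg _).trans (h 0 0)
  refine Real.sqrt_le_iff.2 ⟨by positivity, ?_⟩
  have h1 : ∀ i j, A i j * A i j ≤ N * N := fun i j => by
    have := h i j
    rw [← abs_mul_abs_self (A i j)]
    gcongr
  unfold contract
  simp only [Fin.sum_univ_three]
  nlinarith [h1 0 0, h1 0 1, h1 0 2, h1 1 0, h1 1 1, h1 1 2, h1 2 0, h1 2 1, h1 2 2]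

lemma continuous_frob : Continuous frob := by
  unfold frob contract
  fun_prop

/-- A continuous field with finite `W^{1,∞}` norm is bounded and Lipschitz. -/
lemma bounded_lipschitz_of_normW1inf_lt {u : E3 → Mat3} (hu : Continuous u) {N : ℝ} (hN : 0 ≤ N)
    (h : normW1inf u < ENNReal.ofReal N) :
    (∀ x i j, |u x i j| ≤ N) ∧ ∀ x y i j, |u y i j - u x i j| ≤ 3 * N * ‖x - y‖ := by
  have h1 : essSup (fun x => ENNReal.ofReal (frob (u x))) volume < ENNReal.ofReal N :=
    lt_of_le_of_lt le_self_add h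
  have h2 : (⨅ (G : Fin 3 → E3 → Mat3) (_ : IsWeakGradient u G),
      essSup (fun x => ENNReal.ofReal (gradFrob fun k => G k x)) volume) < ENNReal.ofReal N :=
    lt_of_le_of_lt le_add_self h
  constructor
  · have hae : ∀ᵐ x, frob (u x) ≤ N := by
      filter_upwards [ENNReal.ae_le_essSup fun x => ENNReal.ofReal (frob (u x))] with x hx
      exact (ENNReal.ofReal_le_ofReal_iff hN).1 (hx.trans h1.le)
    -- By continuity the exceptional set is open, and an open null set is empty: the
    -- almost-everywhere bound holds everywhere.
    have hopen : IsOpen {x | N < frob (u x)} := isOpen_lt continuous_const (continuous_frob.comp hu)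
    have hz : volume {x | N < frob (u x)} = 0 := by
      simpa only [not_le] using ae_iff.1 hae
    have hempty := (hopen.measure_eq_zero_iff volume).1 hz
    intro x i j
    refine (abs_apply_le_frob _ i j).trans (not_lt.1 fun hx => ?_)
    exact (hempty.subset (show x ∈ {x | N < frob (u x)} from hx)).elim
  · simp only [iInf_lt_iff] at h2
    obtain ⟨G, hG, hGN⟩ := h2
    intro x y i j
    refine abs_sub_le_of_weak_gradient (w := fun x => u x i j) (G := fun k x => G k x i j)
      (by fun_prop) (fun k φ hφ => (hG k i j).2 φ hφ) (fun k => ?_) x y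
    filter_upwards [ENNReal.ae_le_essSup fun x => ENNReal.ofReal (gradFrob fun k => G k x)]
      with z hz
    exact (abs_apply_le_gradFrob (fun k => G k z) k i j).trans
      ((ENNReal.ofReal_le_ofReal_iff hN).1 (hz.trans hGN.le))

/-- Around each time the solution differs from its value there by less than `1` in `W^{1,∞}`, so a
bound at that time extends to a neighbourhood with `N` raised by `1`. Compactness of `[0,T]` makes
it uniform. -/
lemma IsContinuousInY.exists_uniform_bound {T : ℝ} {L : Fin 3 → ℝ} {Q : ℝ → E3 → Mat3}
    (h : IsContinuousInY T L Q) : ∃ N, 0 ≤ N ∧ ∀ t ∈ Icc 0 T,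
      (∀ x i j, |Q t x i j| ≤ N) ∧ ∀ x y i j, |Q t y i j - Q t x i j| ≤ 3 * N * ‖x - y‖ := by
  refine isCompact_Icc.induction_on (p := fun S => ∃ N, 0 ≤ N ∧ ∀ t ∈ S,
      (∀ x i j, |Q t x i j| ≤ N) ∧ ∀ x y i j, |Q t y i j - Q t x i j| ≤ 3 * N * ‖x - y‖)
    ⟨0, le_rfl, by simp⟩ ?_ ?_ ?_
  · rintro s t hst ⟨N, hN, h⟩
    exact ⟨N, hN, fun r hr => h r (hst hr)⟩
  · rintro s t ⟨N, hN, hs⟩ ⟨N', hN', ht⟩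
    have key : ∀ {n n' : ℝ} {u : E3 → Mat3}, n ≤ n' → ((∀ x i j, |u x i j| ≤ n) ∧
        ∀ x y i j, |u y i j - u x i j| ≤ 3 * n * ‖x - y‖) → ((∀ x i j, |u x i j| ≤ n') ∧
        ∀ x y i j, |u y i j - u x i j| ≤ 3 * n' * ‖x - y‖) := fun hn hu =>
      ⟨fun x i j => (hu.1 x i j).trans hn, fun x y i j => (hu.2 x y i j).trans (by gcongr)⟩
    refine ⟨max N N', le_max_of_le_left hN, fun r hr => ?_⟩
    rcases hr with hr | hr
    · exact key (le_max_left _ _) (hs r hr)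
    · exact key (le_max_right _ _) (ht r hr)
  · intro t ht
    obtain ⟨⟨hc, -, -, hfin⟩, hlim⟩ := h t ht
    set N := (normW1inf (Q t)).toReal + 1 with hN
    have hN0 : 0 ≤ N := by positivity
    have hlt : normW1inf (Q t) < ENNReal.ofReal N := by
      rw [ENNReal.lt_ofReal_iff_toReal_lt hfin.ne]
      linarith
    obtain ⟨hb, hl⟩ := bounded_lipschitz_of_normW1inf_lt hc hN0 hlt
    have hev : ∀ᶠ s in 𝓝[Icc 0 T] t, normW1inf (Q s - Q t) < ENNReal.ofReal 1 :=
      hlim.eventually_lt_const (by simp)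
    refine ⟨_, inter_mem hev self_mem_nhdsWithin, N + 1, by positivity, fun s hs => ?_⟩
    obtain ⟨hb', hl'⟩ := bounded_lipschitz_of_normW1inf_lt ((h s hs.2).1.1.sub hc) zero_le_one hs.1
    simp only [Pi.sub_apply, Matrix.sub_apply] at hb' hl'
    refine ⟨fun x i j => ?_, fun x y i j => ?_⟩
    · have e : Q s x i j = (Q s x i j - Q t x i j) + Q t x i j := by ring
      rw [e]
      refine (abs_add_le _ _).trans ?_
      linarith [hb' x i j, hb x i j]
    · have e : Q s y i j - Q s x i j =
        ((Q s y i j - Q t y i j) - (Q s x i j - Q t x i j)) + (Q t y i j - Q t x i j) := by ring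
      rw [e]
      refine (abs_add_le _ _).trans ?_
      linarith [hl' x y i j, hl x y i j]

lemma IsContinuousInY.continuousOn_apply {T : ℝ} {L : Fin 3 → ℝ} {Q : ℝ → E3 → Mat3}
    (h : IsContinuousInY T L Q) (x : E3) (i j : Fin 3) :
    ContinuousOn (fun s => Q s x i j) (Icc 0 T) := by
  intro t ht
  refine Metric.tendsto_nhds.2 fun ε hε => ?_
  obtain ⟨hQ, hlim⟩ := h t ht
  have hev : ∀ᶠ s in 𝓝[Icc 0 T] t, normW1inf (Q s - Q t) < ENNReal.ofReal (ε / 2) :=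
    hlim.eventually_lt_const (by simpa using hε)
  filter_upwards [hev, self_mem_nhdsWithin] with s hs hsT
  have := (bounded_lipschitz_of_normW1inf_lt ((h s hsT).1.1.sub hQ.1) (by positivity) hs).1 x i j
  rw [Real.dist_eq]
  simp only [Pi.sub_apply, Matrix.sub_apply] at this
  linarith

/-! ### From tensors to the normed space of arrays -/

/-- Arrays with the supremum norm. -/
abbrev Arr3 : Type := Fin 3 → Fin 3 → ℝ

/-- The bulk nonlinearity on arrays. -/
def bulkArr (α β γ : ℝ) (A : Arr3) : Arr3 := bulk α β γ A

lemma bulk_apply (α β γ : ℝ) (A : Mat3) (i j : Fin 3) :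
    bulk α β γ A i j = -(α * A i j) + β * ((∑ k, A i k * A k j) -
      ((1 / 3) * ∑ l, ∑ k, A l k * A k l) * (1 : Mat3) i j) -
        (γ * ∑ l, ∑ k, A l k * A k l) * A i j := by
  simp [bulk, Matrix.trace, Matrix.mul_apply]

lemma contDiff_bulkArr (α β γ : ℝ) {n : WithTop ℕ∞} : ContDiff ℝ n (bulkArr α β γ) := by
  refine contDiff_pi.2 fun i => contDiff_pi.2 fun j => ?_
  have e : (fun A : Arr3 => bulkArr α β γ A i j) = fun A : Arr3 =>
      -(α * A i j) + β * ((∑ k, A i k * A k j) - ((1 / 3) * ∑ l, ∑ k, A l k * A k l) *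
        (1 : Mat3) i j) - (γ * ∑ l, ∑ k, A l k * A k l) * A i j :=
    funext fun A => bulk_apply α β γ A i j
  rw [e]
  fun_prop

lemma norm_le_of_abs_apply_le {A : Arr3} {N : ℝ} (hN : 0 ≤ N) (h : ∀ i j, |A i j| ≤ N) :
    ‖A‖ ≤ N :=
  (pi_norm_le_iff_of_nonneg hN).2 fun i => (pi_norm_le_iff_of_nonneg hN).2 fun j => h i j

lemma abs_apply_le_norm (A : Arr3) (i j : Fin 3) : |A i j| ≤ ‖A‖ :=
  (norm_le_pi_norm (A i) j).trans (norm_le_pi_norm A i)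

lemma integral_smul_apply {φ : E3 → ℝ} {u : E3 → Arr3} (h : Integrable fun x => φ x • u x)
    (i j : Fin 3) : (∫ x, φ x • u x) i j = ∫ x, φ x * u x i j := by
  let l : Arr3 →L[ℝ] ℝ := (ContinuousLinearMap.proj (R := ℝ) (φ := fun _ : Fin 3 => ℝ) j).comp
    (ContinuousLinearMap.proj (R := ℝ) (φ := fun _ : Fin 3 => Fin 3 → ℝ) i)
  have := l.integral_comp_comm h
  exact this.symm

lemma heat_eq_heatConv {t M : ℝ} (ht : 0 < t) {u : E3 → Arr3} (hu : AEStronglyMeasurable u)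
    (hM : ∀ x, ‖u x‖ ≤ M) : heat t u = heatConv t u := by
  have e : heat t u = fun x => Matrix.of fun i j => ∫ y, heatKernel t (x - y) * u y i j :=
    if_pos ht
  rw [e]
  funext x i j
  exact (integral_smul_apply (integrable_heatKernel_smul ht hu hM x) i j).symm

lemma lri1b_eq_scheme {c α β γ τ M : ℝ} (hcτ : 0 < c * τ) {u : E3 → Arr3} (hu : Continuous u)
    (hM : ∀ x, ‖u x‖ ≤ M) (m : ℕ) :
    lri1b c α β γ τ u m = scheme (c * τ) τ (bulkArr α β γ) u m := by
  induction m with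
  | zero => rfl
  | succ m ih =>
    obtain ⟨hm, B, hB⟩ := scheme_measurable_bounded (τ := τ) hcτ
      (contDiff_bulkArr α β γ (n := 0)).continuous hu hM m
    have e := heat_eq_heatConv hcτ hm.aestronglyMeasurable hB
    funext x
    have e' : heat (c * τ) (lri1b c α β γ τ u m) x =
        heatConv (c * τ) (scheme (c * τ) τ (bulkArr α β γ) u m) x := by
      rw [ih]
      exact congrFun e x
    exact congrArg (fun A : Mat3 => A + τ • bulk α β γ A) e'

/-- Testing entry by entry is testing with values in arrays. -/
lemma weak_equation_of_apply {c t M : ℝ} (ht : 0 ≤ t) {q F : ℝ → E3 → Arr3}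
    (hq : Continuous fun p : ℝ × E3 => q p.1 p.2) (hF : Continuous fun p : ℝ × E3 => F p.1 p.2)
    (hM : ∀ s y, ‖q s y‖ ≤ M) (hMF : ∀ s y, ‖F s y‖ ≤ M) {φ : E3 → ℝ} (hφ : IsTest φ)
    (h : ∀ i j, ∫ x, q t x i j * φ x = (∫ x, q 0 x i j * φ x) +
      ∫ s in (0 : ℝ)..t, ∫ x, (c * (q s x i j * Laplacian.laplacian φ x) + F s x i j * φ x)) :
    ∫ x, φ x • q t x = (∫ x, φ x • q 0 x) +
      ∫ s in (0 : ℝ)..t, ∫ x, ((c * Laplacian.laplacian φ x) • q s x + φ x • F s x) := by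
  have hqs : ∀ s, Continuous (q s) := fun s => hq.comp (Continuous.prodMk_right s)
  have hFs : ∀ s, Continuous (F s) := fun s => hF.comp (Continuous.prodMk_right s)
  have hΔc : Continuous (Laplacian.laplacian φ) := continuous_laplacian (hφ.1.of_le two_le_smooth)
  have hΔi : Integrable fun x => c * Laplacian.laplacian φ x := by
    refine (hΔc.integrable_of_hasCompactSupport ?_).const_mul c
    rw [funext (laplacian_eq_sum_partialDeriv (hφ.1.of_le two_le_smooth))]
    simp only [Fin.sum_univ_three]
    have hs := fun i => hasCompactSupport_partialDeriv (hasCompactSupport_partialDeriv hφ.2 i) i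
    exact ((hs 0).add (hs 1)).add (hs 2)
  have hi1 : ∀ s, Integrable fun x => (c * Laplacian.laplacian φ x) • q s x := fun s =>
    integrable_smul_of_bound hΔi (hqs s).aestronglyMeasurable (hM s)
  have hi2 : ∀ s, Integrable fun x => φ x • F s x := fun s =>
    integrable_smul_of_bound hφ.integrable (hFs s).aestronglyMeasurable (hMF s)
  have hi3 : ∀ s, Integrable fun x => φ x • q s x := fun s =>
    integrable_smul_of_bound hφ.integrable (hqs s).aestronglyMeasurable (hM s)
  -- Taking an entry commutes with the time integral only for an integrable integrand.
  have hii : IntervalIntegrable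
      (fun s => ∫ x, ((c * Laplacian.laplacian φ x) • q s x + φ x • F s x)) volume 0 t := by
    rw [intervalIntegrable_iff_integrableOn_Ioc_of_le ht]
    refine Measure.integrableOn_of_bounded
      (M := (∫ x, |c * Laplacian.laplacian φ x| * M) + ∫ x, |φ x| * M) (by simp) ?_
      (Eventually.of_forall fun s => ?_)
    · refine (StronglyMeasurable.integral_prod_right (f := fun s x =>
        (c * Laplacian.laplacian φ x) • q s x + φ x • F s x)
        (Continuous.stronglyMeasurable ?_)).aestronglyMeasurable
      exact ((continuous_const.mul (hΔc.comp continuous_snd)).smul hq).add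
        ((hφ.1.continuous.comp continuous_snd).smul hF)
    · rw [integral_add (hi1 s) (hi2 s)]
      refine (norm_add_le _ _).trans (add_le_add ?_ ?_)
      · refine norm_integral_le_of_norm_le (hΔi.abs.mul_const M) (Eventually.of_forall fun x => ?_)
        rw [norm_smul, Real.norm_eq_abs]
        exact mul_le_mul_of_nonneg_left (hM s x) (abs_nonneg _)
      · refine norm_integral_le_of_norm_le (hφ.integrable.abs.mul_const M)
          (Eventually.of_forall fun x => ?_)
        rw [norm_smul, Real.norm_eq_abs]
        exact mul_le_mul_of_nonneg_left (hMF s x) (abs_nonneg _)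
  ext i j
  let l : Arr3 →L[ℝ] ℝ := (ContinuousLinearMap.proj (R := ℝ) (φ := fun _ : Fin 3 => ℝ) j).comp
    (ContinuousLinearMap.proj (R := ℝ) (φ := fun _ : Fin 3 => Fin 3 → ℝ) i)
  have e := l.intervalIntegral_comp_comm hii
  have e' : (∫ s in (0 : ℝ)..t, ∫ x,
      ((c * Laplacian.laplacian φ x) • q s x + φ x • F s x)) i j =
      ∫ s in (0 : ℝ)..t, ∫ x, (c * (q s x i j * Laplacian.laplacian φ x) + F s x i j * φ x) := by
    refine e.symm.trans (intervalIntegral.integral_congr fun s _ => ?_)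
    refine (l.integral_comp_comm ((hi1 s).add (hi2 s))).symm.trans
      (integral_congr_ae (Eventually.of_forall fun x => ?_))
    simp [l]
    ring
  rw [Pi.add_apply, Pi.add_apply, e', integral_smul_apply (hi3 t), integral_smul_apply (hi3 0)]
  simp_rw [mul_comm (φ _)]
  exact h i j

/-- A solution in `C([0,T]; 𝒴)`, continued constantly in time, is a bounded weak solution, Lipschitz
in space. -/
lemma IsSolution.isBoundedWeakSolution {c α β γ T : ℝ} (hT : 0 < T) {L : Fin 3 → ℝ}
    {Q₀ : E3 → Mat3} {Q : ℝ → E3 → Mat3} (hQY : IsContinuousInY T L Q)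
    (hQ : IsSolution c α β γ T L Q₀ Q) :
    ∃ (q : ℝ → E3 → Arr3) (M Λ : ℝ), (∀ t ∈ Icc 0 T, q t = Q t) ∧ 0 ≤ M ∧ 0 ≤ Λ ∧
      IsBoundedWeakSolution c T M q (fun s y => bulkArr α β γ (q s y)) ∧
      ∀ s x y, ‖q s y - q s x‖ ≤ Λ * ‖x - y‖ := by
  obtain ⟨N, hN, hb⟩ := hQY.exists_uniform_bound
  -- Freezing the solution outside `[0,T]` makes continuity and bounds hold for all real times; the
  -- equation is required only on `[0,T]`.
  let p : ℝ → Icc (0 : ℝ) T := projIcc 0 T hT.le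
  let q : ℝ → E3 → Arr3 := fun s => Q (p s)
  have hqQ : ∀ t ∈ Icc 0 T, q t = Q t := fun t ht =>
    congrArg (fun r : Icc (0 : ℝ) T => Q r) (projIcc_of_mem hT.le ht)
  have hqN : ∀ s y, ‖q s y‖ ≤ N := fun s y =>
    norm_le_of_abs_apply_le hN fun i j => (hb (p s) (p s).2).1 y i j
  have hLip : ∀ s x y, ‖q s y - q s x‖ ≤ 3 * N * ‖x - y‖ := fun s x y =>
    norm_le_of_abs_apply_le (by positivity) fun i j => (hb (p s) (p s).2).2 x y i j
  have hqt : ∀ x, Continuous fun s => q s x := fun x =>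
    continuous_pi fun i => continuous_pi fun j =>
      (hQY.continuousOn_apply x i j).comp_continuous
        (continuous_subtype_val.comp continuous_projIcc) fun s => (p s).2
  -- Joint continuity follows from continuity in time at each point and a Lipschitz constant in
  -- space that does not depend on time.
  have hqc : Continuous fun r : ℝ × E3 => q r.1 r.2 := by
    refine continuous_prod_of_continuous_lipschitzWith' _ (3 * N).toNNReal (fun s => ?_) hqt
    refine LipschitzWith.of_dist_le_mul fun x y => ?_
    rw [dist_eq_norm, dist_eq_norm, Real.coe_toNNReal _ (by positivity), norm_sub_rev x y]
    exact hLip s y x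
  have hfc : Continuous (bulkArr α β γ) := (contDiff_bulkArr α β γ (n := 0)).continuous
  obtain ⟨N', hN'⟩ := (isCompact_closedBall (0 : Arr3) N).exists_bound_of_continuousOn
    hfc.continuousOn
  have hfN : ∀ s y, ‖bulkArr α β γ (q s y)‖ ≤ N' := fun s y =>
    hN' _ (mem_closedBall_zero_iff.2 (hqN s y))
  have h0 : q 0 = Q₀ := (hqQ 0 ⟨le_rfl, hT.le⟩).trans hQ.initial
  refine ⟨q, max N N', 3 * N, hqQ, le_max_of_le_left hN, by positivity,
    ⟨hqc, hfc.comp hqc, fun s y => (hqN s y).trans (le_max_left _ _),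
      fun s y => (hfN s y).trans (le_max_right _ _), fun t ht φ hφ => ?_⟩, hLip⟩
  refine weak_equation_of_apply (M := max N N') ht.1 hqc (hfc.comp hqc)
    (fun s y => (hqN s y).trans (le_max_left _ _))
    (fun s y => (hfN s y).trans (le_max_right _ _)) hφ fun i j => ?_
  have h := hQ.equation t ht i j φ hφ
  rw [h0, hqQ t ht]
  refine h.trans ?_
  congr 1
  refine intervalIntegral.integral_congr fun s hs => ?_
  rw [uIcc_of_le ht.1] at hs
  simp only [bulkArr]
  rw [hqQ s ⟨hs.1, hs.2.trans ht.2⟩]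

end QTensor

end

/-! ### The convergence estimate in the norm of `𝒵` -/

theorem theorem4p3
    (c α β γ : ℝ) (hc : 0 < c) (hβ : 0 < β) (hγ : 0 < γ)
    (a C Cf Cd : ℝ) (ha : 0 < a) (hb : QTensor.bConst α β γ ≤ a ^ 2)
    (hC : 0 < C) (hconst : QTensor.IsBulkConstants α β γ a C Cf Cd)
    (T : ℝ) (hT : 0 < T) (L : Fin 3 → ℝ) (hL : ∀ i, 0 < L i)
    (Q₀ : QTensor.E3 → QTensor.Mat3) (Q : ℝ → QTensor.E3 → QTensor.Mat3)
    (hQ₀ : ∀ x, QTensor.frob (Q₀ x) ^ 2 ≤ a ^ 2)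
    (hQY : QTensor.IsContinuousInY T L Q)
    (hQ : QTensor.IsSolution c α β γ T L Q₀ Q) :
    ∃ C₅ : ℝ, 0 < C₅ ∧ ∀ n : ℕ, 1 ≤ n → ∀ τ : ℝ, τ = T / n →
      τ ≤ QTensor.tauZero α β γ a Cf Cd →
        ∀ m : ℕ, 1 ≤ m → m ≤ n →
          QTensor.normZ L (QTensor.lri1b c α β γ τ Q₀ m - Q (m * τ)) ≤
            ENNReal.ofReal (C₅ * (Real.exp (C * T) - 1) / C * τ) := by
  obtain ⟨q, M, Λ, hqQ, hM, hΛ, hq, hLip⟩ := QTensor.IsSolution.isBoundedWeakSolution hT hQY hQ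
  obtain ⟨K, hK, h⟩ := QTensor.exists_norm_scheme_sub_le hq hc hT hM
    (QTensor.contDiff_bulkArr α β γ) hΛ hLip
  have hE : 0 < Real.exp (C * T) - 1 := by
    have := Real.add_one_lt_exp (mul_pos hC hT).ne'
    nlinarith [mul_pos hC hT]
  -- Chosen so that `C₅ (e^{CT} - 1) / C = 3 K`. The factor `3` passes from the largest of the nine
  -- entries to the Frobenius norm.
  refine ⟨3 * K * C / (Real.exp (C * T) - 1), by positivity, fun n hn τ hτ _ m _ hmn => ?_⟩
  have hn' : (0 : ℝ) < n := by exact_mod_cast hn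
  have hτ0 : 0 < τ := by rw [hτ]; positivity
  have hC₅ : 3 * K * C / (Real.exp (C * T) - 1) * (Real.exp (C * T) - 1) / C * τ =
      3 * (K * τ) := by
    field_simp
  have hq0 : q 0 = Q₀ := (hqQ 0 ⟨le_rfl, hT.le⟩).trans hQ.initial
  have hmT : (m * τ : ℝ) ∈ Set.Icc 0 T := by
    refine ⟨by positivity, ?_⟩
    have hmn' : (m : ℝ) ≤ n := by exact_mod_cast hmn
    calc (m * τ : ℝ) ≤ n * τ := by gcongr
      _ = T := by rw [hτ]; field_simp
  have hcont : Continuous (q 0) := hq.cont.comp (Continuous.prodMk_right 0)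
  have hs := QTensor.lri1b_eq_scheme (α := α) (β := β) (γ := γ) (mul_pos hc hτ0) hcont
    (hq.bound 0) m
  rw [hC₅]
  refine iSup₂_le fun x _ => ENNReal.ofReal_le_ofReal
    (QTensor.frob_le_of_abs_apply_le fun i j => ?_)
  rw [← hq0, ← hqQ _ hmT]
  have h1 := h n hn τ hτ m hmn x
  rw [← hs] at h1
  exact (QTensor.abs_apply_le_norm _ i j).trans h1
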